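/- Tense formulas are built from countably many variables $p_0,p_1,\dots$ by $\bot$, $\to$, $\Box$ (future necessity) and $\blacklozenge$ (past possibility). A tense logic is a set $L$ of formulas that contains all classical tautologies, is closed under modus ponens and substitution, and satisfies $\blacklozenge\varphi\to\psi\in L$ if and only if $\varphi\to\Box\psi\in L$. Let $\mathsf{K4}_t$ be the least tense logic containing $\Box p\to\Box\Box p$. For a tense logic $L_0$ let $\mathsf{NExt}(L_0)$ be the complete lattice of tense logics containing $L_0$, ordered by inclusion. A pair $\langle L_1,L_2\rangle$ of elements of $\mathsf{NExt}(L_0)$ is a splitting pair in $\mathsf{NExt}(L_0)$ if for every $L\in\mathsf{NExt}(L_0)$ exactly one of $L\subseteq L_1$ and $L\supseteq L_2$ holds; then $L_1$ is said to split $\mathsf{NExt}(L_0)$, and $L_2$, which is determined by $L_0$ and $L_1$, is called a splitting of $\mathsf{NExt}(L_0)$ and is denoted by $L_0/L_1$. A union-splitting in $\mathsf{NExt}(L_0)$ is the supremum in $\mathsf{NExt}(L_0)$ of a (possibly empty) family of splittings of $\mathsf{NExt}(L_0)$. An iterated splitting in $\mathsf{NExt}(L_0)$ is a logic $L_0/L_1/\cdots/L_n$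 with $n\ge 0$, where $L_i$ splits $\mathsf{NExt}(L_0/L_1/\cdots/L_{i-1})$ for all $1\le i\le n$. A frame is a nonempty set $X$ with a relation $R\subseteq X\times X$; under a valuation, $\Box\varphi$ holds at $x$ if and only if $\varphi$ holds at all $y$ with $Rxy$, and $\blacklozenge\varphi$ holds at $x$ if and only if $\varphi$ holds at some $y$ with $Ryx$. A formula is valid in a frame if it holds at every point under every valuation. Let $\mathsf{Fr}(L)$ and $\mathsf{Fin}(L)$ be the classes of all frames and of all finite frames, respectively, in which every formula of $L$ is valid. Let $\bullet$ be the frame with one point and empty relation, and $\mathsf{Log}(\bullet)$ the set of formulas valid in it. For $L\in\mathsf{NExt}(\mathsf{K4}_t)$ put $$\mathsf{deg}(L)=|\{L'\in\mathsf{NExt}(\mathsf{K4}_t):\mathsf{Fr}(L')=\mathsf{Fr}(L)\}|,\qquad \mathsf{df}(L)=|\{L'\in\mathsf{NExt}(\mathsf{K4}_t):\mathsf{Fin}(L')=\mathsf{Fin}(L)\}|.$$ **Theorem.** The logic $\mathsf{Log}(\bullet)$ splits $\mathsf{NExt}(\mathsf{K4}_t)$, and for every $L\in\mathsf{NExt}(\mathsf{K4}_t)$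 the following are equivalent: 1. $L$ is a union-splitting in $\mathsf{NExt}(\mathsf{K4}_t)$; 2. $L$ is an iterated splitting in $\mathsf{NExt}(\mathsf{K4}_t)$; 3. $\mathsf{df}(L)=1$; 4. $\mathsf{deg}(L)=1$; 5. $\mathsf{df}(L)\neq 2^{\aleph_0}$; 6. $\mathsf{deg}(L)\neq 2^{\aleph_0}$; 7. $L=\mathsf{K4}_t$ or $L=\mathsf{K4}_t/\mathsf{Log}(\bullet)$. -/

import Mathlib

universe u

namespace Tense

/-- Formulas of the language of tense logic: variables `p_i`, falsum, implication,
the future necessity operator `□` and the past possibility operator `⧫`. -/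
inductive Formula : Type
  | var : ℕ → Formula
  | bot : Formula
  | imp : Formula → Formula → Formula
  | box : Formula → Formula
  | pdia : Formula → Formula

namespace Formula

/-- The homomorphism of the formula algebra determined by its values on the variables. -/
def subst (s : ℕ → Formula) : Formula → Formula
  | var n => s n
  | bot => bot
  | imp φ ψ => imp (subst s φ) (subst s ψ)
  | box φ => box (subst s φ)
  | pdia φ => pdia (subst s φ)

/-- Classical propositional evaluation: `v` interprets the variables and the formulas
`□φ` and `⧫φ`, which are treated as atoms. -/
def propEval (v : Formula → Prop) : Formula → Prop
  | var n => v (var n)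
  | bot => False
  | imp φ ψ => propEval v φ → propEval v ψ
  | box φ => v (box φ)
  | pdia φ => v (pdia φ)

/-- `φ` is (an instance of) a classical propositional tautology. -/
def IsTautology (φ : Formula) : Prop := ∀ v : Formula → Prop, propEval v φ

/-- The axiom `(4)`: `□p → □□p`. -/
def axiom4 : Formula := imp (box (var 0)) (box (box (var 0)))

end Formula

/-- A tense logic: a set of formulas that contains classical propositional logic, satisfies
`⧫φ → ψ ∈ L ↔ φ → □ψ ∈ L`, and is closed under modus ponens and substitution. -/
@[ext]
structure TenseLogic where
  carrier : Set Formula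
  taut : ∀ φ : Formula, φ.IsTautology → φ ∈ carrier
  adj : ∀ φ ψ : Formula,
    Formula.imp (Formula.pdia φ) ψ ∈ carrier ↔ Formula.imp φ (Formula.box ψ) ∈ carrier
  mp : ∀ φ ψ : Formula, φ ∈ carrier → Formula.imp φ ψ ∈ carrier → ψ ∈ carrier
  subst : ∀ (s : ℕ → Formula) (φ : Formula), φ ∈ carrier → φ.subst s ∈ carrier

namespace TenseLogic

/-- Tense logics are ordered by inclusion. -/
instance : PartialOrder TenseLogic :=
  PartialOrder.lift TenseLogic.carrier (fun _ _ h => TenseLogic.ext h)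

/-- The intersection of a set of tense logics (all formulas, if the set is empty). -/
instance : InfSet TenseLogic where
  sInf S :=
    { carrier := {φ | ∀ L ∈ S, φ ∈ L.carrier}
      taut := fun φ h L _ => L.taut φ h
      adj := fun φ ψ =>
        ⟨fun h L hL => (L.adj φ ψ).1 (h L hL), fun h L hL => (L.adj φ ψ).2 (h L hL)⟩
      mp := fun φ ψ h₁ h₂ L hL => L.mp φ ψ (h₁ L hL) (h₂ L hL)
      subst := fun s φ h L hL => L.subst s φ (h L hL) }

/-- The complete lattice of tense logics: meets are intersections, `⊔` and `sSup` give the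
least tense logic that contains the given ones, and `⊥` is the least tense logic. -/
instance : CompleteLattice TenseLogic :=
  completeLatticeOfInf TenseLogic (fun _ =>
    ⟨fun L hL _ h => h L hL, fun _ hL _ h _ hM => hL hM h⟩)

end TenseLogic

/-- The least tense logic `K_t`. -/
def Kt : TenseLogic := ⊥

/-- `L ⊕ Σ`: the least tense logic containing `L ∪ Σ`. -/
def oplus (L : TenseLogic) (Γ : Set Formula) : TenseLogic :=
  sInf {M : TenseLogic | L.carrier ∪ Γ ⊆ M.carrier}

/-- `K4_t = K_t ⊕ (□p → □□p)`. -/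
def K4t : TenseLogic := oplus Kt {Formula.axiom4}

/-- `NExt(L₀)`: the tense logics extending `L₀`. -/
def NExt (L₀ : TenseLogic) : Set TenseLogic := {L | L₀ ≤ L}

/-- A (Kripke) frame: a nonempty set with a binary relation. -/
structure Frame : Type (u + 1) where
  World : Type u
  nonempty : Nonempty World
  R : World → World → Prop

namespace Frame

/-- The extension of a valuation to all formulas. -/
def eval (F : Frame.{u}) (V : ℕ → Set F.World) : Formula → Set F.World
  | .var n => V n
  | .bot => ∅
  | .imp φ ψ => (F.eval V φ)ᶜ ∪ F.eval V ψ
  | .box φ => {x | ∀ y, F.R x y → y ∈ F.eval V φ}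
  | .pdia φ => {x | ∃ y, F.R y x ∧ y ∈ F.eval V φ}

/-- `φ` is valid in `F`. -/
def Valid (F : Frame.{u}) (φ : Formula) : Prop :=
  ∀ (V : ℕ → Set F.World) (x : F.World), x ∈ F.eval V φ

theorem mem_eval_imp (F : Frame.{u}) (V : ℕ → Set F.World) (φ ψ : Formula) (x : F.World) :
    x ∈ F.eval V (.imp φ ψ) ↔ (x ∈ F.eval V φ → x ∈ F.eval V ψ) := by
  simp only [eval, Set.mem_union, Set.mem_compl_iff]
  tauto

theorem propEval_iff (F : Frame.{u}) (V : ℕ → Set F.World) (x : F.World) (φ : Formula) :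
    Formula.propEval (fun ψ => x ∈ F.eval V ψ) φ ↔ x ∈ F.eval V φ := by
  induction φ with
  | var n => exact Iff.rfl
  | bot => exact Iff.rfl
  | imp φ ψ h₁ h₂ =>
    rw [mem_eval_imp, ← h₁, ← h₂]
    exact Iff.rfl
  | box φ _ => exact Iff.rfl
  | pdia φ _ => exact Iff.rfl

theorem eval_subst (F : Frame.{u}) (V : ℕ → Set F.World) (s : ℕ → Formula) (φ : Formula) :
    F.eval V (φ.subst s) = F.eval (fun n => F.eval V (s n)) φ := by
  induction φ with
  | var n => rfl
  | bot => rfl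
  | imp φ ψ h₁ h₂ => simp only [Formula.subst, eval, h₁, h₂]
  | box φ h => simp only [Formula.subst, eval, h]
  | pdia φ h => simp only [Formula.subst, eval, h]

/-- `Log(F)`: the tense logic of a frame. -/
def log (F : Frame.{u}) : TenseLogic where
  carrier := {φ | F.Valid φ}
  taut φ h V x := (F.propEval_iff V x φ).1 (h _)
  adj φ ψ := by
    constructor
    · intro h V x
      rw [mem_eval_imp]
      intro hx y hxy
      exact (F.mem_eval_imp V _ _ y).1 (h V y) ⟨x, hxy, hx⟩
    · intro h V y
      rw [mem_eval_imp]
      rintro ⟨x, hxy, hx⟩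
      exact (F.mem_eval_imp V _ _ x).1 (h V x) hx y hxy
  mp φ ψ h₁ h₂ V x := (F.mem_eval_imp V φ ψ x).1 (h₂ V x) (h₁ V x)
  subst s φ h V x := by
    rw [eval_subst]
    exact h _ x

/-- The frame `•`: one irreflexive point. -/
def bullet : Frame.{0} where
  World := Unit
  nonempty := ⟨()⟩
  R _ _ := False

end Frame

/-- `Fr(L)`: the class of frames that validate every formula of `L`. -/
def Fr (L : TenseLogic) : Set Frame.{u} := {F | ∀ φ ∈ L.carrier, F.Valid φ}

/-- `Fin(L)`: the class of finite frames that validate every formula of `L`. -/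
def FinFr (L : TenseLogic) : Set Frame.{u} :=
  {F | Finite F.World ∧ ∀ φ ∈ L.carrier, F.Valid φ}

/-- The degree of Kripke-incompleteness of `L` in `NExt(L₀)`. -/
noncomputable def deg (L₀ L : TenseLogic) : Cardinal.{0} :=
  Cardinal.mk {L' : TenseLogic // L' ∈ NExt L₀ ∧ Fr.{u} L' = Fr.{u} L}

/-- The degree of the finite model property of `L` in `NExt(L₀)`. -/
noncomputable def df (L₀ L : TenseLogic) : Cardinal.{0} :=
  Cardinal.mk {L' : TenseLogic // L' ∈ NExt L₀ ∧ FinFr.{u} L' = FinFr.{u} L}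

/-- `⟨L₁, L₂⟩` is a splitting pair in `NExt(L₀)`. In this case `L₂` is uniquely determined by
`L₀` and `L₁` (it is the least `L ∈ NExt(L₀)` with `L ⊈ L₁`) and is denoted `L₀/L₁`. -/
def IsSplittingPair (L₀ L₁ L₂ : TenseLogic) : Prop :=
  L₁ ∈ NExt L₀ ∧ L₂ ∈ NExt L₀ ∧ ∀ L ∈ NExt L₀, Xor (L ≤ L₁) (L₂ ≤ L)

/-- `L` is a splitting of `NExt(L₀)` (by some logic `L₁`). -/
def IsSplitting (L₀ L : TenseLogic) : Prop := ∃ L₁, IsSplittingPair L₀ L₁ L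

/-- `L` is a union-splitting in `NExt(L₀)`: the supremum in `NExt(L₀)` of a family of splittings
of `NExt(L₀)`. The supremum in `NExt(L₀)` of the empty family is `L₀`. -/
def IsUnionSplitting (L₀ L : TenseLogic) : Prop :=
  ∃ S : Set TenseLogic, (∀ M ∈ S, IsSplitting L₀ M) ∧ L = L₀ ⊔ sSup S

/-- `L` is an iterated splitting in `NExt(L₀)`: `L = L₀/L₁/⋯/Lₙ` with `n ≥ 0`, where each `Lᵢ`
splits `NExt(L₀/L₁/⋯/Lᵢ₋₁)`. -/
inductive IsIteratedSplitting (L₀ : TenseLogic) : TenseLogic → Prop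
  | base : IsIteratedSplitting L₀ L₀
  | step (L L₁ L₂ : TenseLogic) : IsIteratedSplitting L₀ L → IsSplittingPair L L₁ L₂ →
      IsIteratedSplitting L₀ L₂

end Tense

/-! A formula with constants substituted for its variables has at an isolated point the value it has
in •. So a logic not contained in `Log(•)` proves that every point has a predecessor or a successor,
and `Log(•)` splits off `K4tLinked` (`isSplittingPair_bullet`). Transitive filtration gives `K4t`
and `K4tLinked` the finite model property (`exists_finite_countermodel`), and each of them is then
determined by its finite frames (`eq_of_finFr_eq`), so both degrees are one.

Any other L contains some φ refuted at a linked point of a finite transitive frame F. Copies of a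
component of F are joined in a zigzag that is long compared with the modal depth of φ: the first
copy still refutes φ, while a new minimal point s sits at the far end. From s hangs a copy of (ℕ,
<), of which s sees the numbers from i on, and only eventually constant sets are admitted
(`exists_base`). The numbers then satisfy a weak Löb axiom for the past and an axiom against endless
alternation. No point of a transitive Kripke frame with a nonempty serial future satisfies both
(`not_pastLob_and_nonAlternating`). Hence intersecting L with logics of such general frames adds no
Kripke frame, while a formula `mark` reads off i. Subsets of ℕ thus yield continuum many logics with
the frames of L (`deg_eq_of_ne`).

The same general frames exclude further splittings, over `K4t` as well as over `K4tLinked`: the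
splitting logic would contain both `F.log` and `addNatLog`, which disagree on the existence of
points of large depth, so it would be inconsistent (`eq_of_isSplittingPair`). -/

namespace Tense

/-! ### Derived connectives and subformulas -/

namespace Formula

/-- Negation. -/
def neg (φ : Formula) : Formula := imp φ bot
/-- Truth. -/
def top : Formula := neg bot
/-- Disjunction. -/
def or (φ ψ : Formula) : Formula := imp (neg φ) ψ
/-- Conjunction. -/
def and (φ ψ : Formula) : Formula := neg (imp φ (neg ψ))
/-- Future possibility. -/
def dia (φ : Formula) : Formula := neg (box (neg φ))
/-- Past necessity. -/
def pbox (φ : Formula) : Formula := neg (pdia (neg φ))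

/-- The set of subformulas. -/
def sub : Formula → Set Formula
  | var n => {var n}
  | bot => {bot}
  | imp φ ψ => {imp φ ψ} ∪ (sub φ ∪ sub ψ)
  | box φ => {box φ} ∪ sub φ
  | pdia φ => {pdia φ} ∪ sub φ

theorem finite_sub (φ : Formula) : φ.sub.Finite := by
  induction φ with
  | var n => exact Set.finite_singleton _
  | bot => exact Set.finite_singleton _
  | imp φ ψ h₁ h₂ => exact (Set.finite_singleton _).union (h₁.union h₂)
  | box φ h => exact (Set.finite_singleton _).union h
  | pdia φ h => exact (Set.finite_singleton _).union h

theorem mem_sub_self (φ : Formula) : φ ∈ φ.sub := by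
  cases φ <;> simp [sub]

theorem sub_subset {φ ψ : Formula} (h : ψ ∈ φ.sub) : ψ.sub ⊆ φ.sub := by
  induction φ with
  | var n => simp only [sub, Set.mem_singleton_iff] at h; rw [h]
  | bot => simp only [sub, Set.mem_singleton_iff] at h; rw [h]
  | imp φ χ h₁ h₂ =>
    rcases h with h | h | h
    · rw [Set.mem_singleton_iff.1 h]
    · exact (h₁ h).trans fun _ hx => Or.inr (Or.inl hx)
    · exact (h₂ h).trans fun _ hx => Or.inr (Or.inr hx)
  | box φ h₁ =>
    rcases h with h | h
    · rw [Set.mem_singleton_iff.1 h]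
    · exact (h₁ h).trans fun _ hx => Or.inr hx
  | pdia φ h₁ =>
    rcases h with h | h
    · rw [Set.mem_singleton_iff.1 h]
    · exact (h₁ h).trans fun _ hx => Or.inr hx

theorem left_mem_sub {φ ψ χ : Formula} (h : imp ψ χ ∈ φ.sub) : ψ ∈ φ.sub :=
  sub_subset h (Or.inr (Or.inl (mem_sub_self ψ)))

theorem right_mem_sub {φ ψ χ : Formula} (h : imp ψ χ ∈ φ.sub) : χ ∈ φ.sub :=
  sub_subset h (Or.inr (Or.inr (mem_sub_self χ)))

theorem box_arg_mem_sub {φ ψ : Formula} (h : box ψ ∈ φ.sub) : ψ ∈ φ.sub :=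
  sub_subset h (Or.inr (mem_sub_self ψ))

theorem pdia_arg_mem_sub {φ ψ : Formula} (h : pdia ψ ∈ φ.sub) : ψ ∈ φ.sub :=
  sub_subset h (Or.inr (mem_sub_self ψ))

/-- "There is an earlier or a later point." -/
def linked : Formula := or (dia top) (pdia top)

end Formula

open Formula

/-! ### Deduction from the adjunction between past possibility and future necessity -/

namespace TenseLogic

variable (L : TenseLogic)

instance : Membership Formula TenseLogic := ⟨fun L φ => φ ∈ L.carrier⟩

variable {L} {φ ψ χ : Formula}

theorem le_iff {L M : TenseLogic} : L ≤ M ↔ ∀ φ ∈ L, φ ∈ M := Iff.rfl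

theorem mp₁ (h : φ ∈ L) (t : IsTautology (imp φ ψ)) : ψ ∈ L := L.mp _ _ h (L.taut _ t)

theorem mp₂ (h₁ : φ ∈ L) (h₂ : ψ ∈ L) (t : IsTautology (imp φ (imp ψ χ))) : χ ∈ L :=
  L.mp _ _ h₂ (L.mp _ _ h₁ (L.taut _ t))

theorem imp_refl (φ : Formula) : imp φ φ ∈ L := L.taut _ fun _ h => h

theorem imp_trans (h₁ : imp φ ψ ∈ L) (h₂ : imp ψ χ ∈ L) : imp φ χ ∈ L :=
  mp₂ h₁ h₂ fun _ a b c => b (a c)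

theorem imp_box_pdia (φ : Formula) : imp φ (box (pdia φ)) ∈ L := (L.adj _ _).1 (imp_refl _)

theorem pdia_box_imp (φ : Formula) : imp (pdia (box φ)) φ ∈ L := (L.adj _ _).2 (imp_refl _)

theorem box_mono (h : imp φ ψ ∈ L) : imp (box φ) (box ψ) ∈ L :=
  (L.adj _ _).1 (imp_trans (pdia_box_imp φ) h)

theorem pdia_mono (h : imp φ ψ ∈ L) : imp (pdia φ) (pdia ψ) ∈ L :=
  (L.adj _ _).2 (imp_trans h (imp_box_pdia ψ))

theorem nec (h : φ ∈ L) : box φ ∈ L := by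
  have h₁ : imp (pdia top) φ ∈ L := mp₁ h fun _ a _ => a
  exact mp₁ ((L.adj _ _).1 h₁) fun _ a => a id

/-- A right adjoint preserves meets: the past possibility of `□(φ → ψ) ∧ □φ` implies both `φ → ψ`
and `φ`, hence `ψ`, and the adjunction moves the operator back. -/
theorem box_imp (φ ψ : Formula) : imp (box (imp φ ψ)) (imp (box φ) (box ψ)) ∈ L := by
  have h₁ : imp (pdia (and (box (imp φ ψ)) (box φ))) (imp φ ψ) ∈ L :=
    imp_trans (pdia_mono (L.taut _ fun v => by simp [Formula.and, neg, propEval]; tauto))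
      (pdia_box_imp _)
  have h₂ : imp (pdia (and (box (imp φ ψ)) (box φ))) φ ∈ L :=
    imp_trans (pdia_mono (L.taut _ fun v => by simp [Formula.and, neg, propEval])) (pdia_box_imp _)
  have h₃ : imp (pdia (and (box (imp φ ψ)) (box φ))) ψ ∈ L := mp₂ h₁ h₂ fun _ a b c => a c (b c)
  exact mp₁ ((L.adj _ _).1 h₃) fun v => by simp [Formula.and, neg, propEval]

theorem pdia_or (φ ψ : Formula) : imp (pdia (or φ ψ)) (or (pdia φ) (pdia ψ)) ∈ L := by
  have h₁ : imp φ (box (or (pdia φ) (pdia ψ))) ∈ L :=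
    imp_trans (imp_box_pdia φ)
      (box_mono (L.taut _ fun v => by simp [Formula.or, neg, propEval]; tauto))
  have h₂ : imp ψ (box (or (pdia φ) (pdia ψ))) ∈ L :=
    imp_trans (imp_box_pdia ψ)
      (box_mono (L.taut _ fun v => by simp [Formula.or, neg, propEval]; tauto))
  exact (L.adj _ _).2 (mp₂ h₁ h₂ fun v => by simp only [Formula.or, neg, propEval]; tauto)

theorem pdia_bot : neg (pdia bot) ∈ L := (L.adj _ _).2 (L.taut _ fun _ h => h.elim)

end TenseLogic

open TenseLogic

theorem mem_oplus_of_mem {L : TenseLogic} {Γ : Set Formula} {φ : Formula} (h : φ ∈ Γ) :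
    φ ∈ oplus L Γ := fun _ hM => hM (Or.inr h)

theorem le_oplus (L : TenseLogic) (Γ : Set Formula) : L ≤ oplus L Γ :=
  fun _ h _ hM => hM (Or.inl h)

theorem oplus_le {L M : TenseLogic} {Γ : Set Formula} (h₁ : L ≤ M) (h₂ : ∀ φ ∈ Γ, φ ∈ M) :
    oplus L Γ ≤ M := fun _ h => h M (Set.union_subset h₁ h₂)

theorem K4t_le {L : TenseLogic} (h : axiom4 ∈ L) : K4t ≤ L :=
  oplus_le bot_le fun _ hφ => Set.mem_singleton_iff.1 hφ ▸ h

theorem box_four {L : TenseLogic} (hL : K4t ≤ L) (φ : Formula) :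
    imp (box φ) (box (box φ)) ∈ L :=
  L.subst (fun _ => φ) _ (hL (mem_oplus_of_mem rfl))

/-- Two applications of the adjunction turn this into an instance of (4) for the future. -/
theorem pdia_four {L : TenseLogic} (hL : K4t ≤ L) (φ : Formula) :
    imp (pdia (pdia φ)) (pdia φ) ∈ L :=
  (L.adj _ _).2 ((L.adj _ _).2 (imp_trans (imp_box_pdia φ) (box_four hL _)))

/-! ### Maximal theories and the canonical relation -/

/-- A theory over `L`: a set of formulas containing `L` and closed under modus ponens. -/
structure IsTheory (L : TenseLogic) (T : Set Formula) : Prop where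
  sub : L.carrier ⊆ T
  mp : ∀ {φ ψ}, φ ∈ T → imp φ ψ ∈ T → ψ ∈ T

namespace IsTheory

variable {L : TenseLogic} {T : Set Formula} {φ ψ χ : Formula}

theorem taut₁ (hT : IsTheory L T) (h : φ ∈ T) (t : IsTautology (imp φ ψ)) : ψ ∈ T :=
  hT.mp h (hT.sub (L.taut _ t))

theorem taut₂ (hT : IsTheory L T) (h₁ : φ ∈ T) (h₂ : ψ ∈ T)
    (t : IsTautology (imp φ (imp ψ χ))) : χ ∈ T :=
  hT.mp h₂ (hT.taut₁ h₁ t)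

/-- The theory obtained by adding one formula. -/
theorem adjoin (hT : IsTheory L T) (φ : Formula) : IsTheory L {ψ | imp φ ψ ∈ T} where
  sub _ h := hT.taut₁ (hT.sub h) fun _ a _ => a
  mp h₁ h₂ := hT.taut₂ h₁ h₂ fun _ a b c => b c (a c)

theorem boxes (hT : IsTheory L T) : IsTheory L {ψ | box ψ ∈ T} where
  sub _ h := hT.sub (nec h)
  mp h₁ h₂ := hT.mp h₁ (hT.mp h₂ (hT.sub (box_imp _ _)))

/-- Maximal extensions of this theory are the canonical predecessors of `T`, just as those of the
theory in `boxes` are the successors. -/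
theorem pboxes (hT : IsTheory L T) : IsTheory L {ψ | pbox ψ ∈ T} where
  sub φ h := by
    have h₁ : imp (neg φ) bot ∈ L := mp₁ (φ := φ) h fun _ a b => b a
    exact hT.sub (imp_trans (pdia_mono h₁) pdia_bot)
  mp := by
    intro φ ψ h₁ h₂
    have h₃ : imp (pdia (neg ψ)) (pdia (or (neg φ) (neg (imp φ ψ)))) ∈ L :=
      pdia_mono (L.taut _ fun v => by simp only [Formula.or, neg, propEval]; tauto)
    have h₄ := imp_trans h₃ (pdia_or _ _)
    exact hT.mp h₂ (hT.taut₂ h₁ (hT.sub h₄) fun v => by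
      simp only [Formula.or, neg, propEval]; tauto)

end IsTheory

/-- Maximal consistent theories over `L`. -/
structure IsMaximal (L : TenseLogic) (T : Set Formula) : Prop extends IsTheory L T where
  bot_notMem : bot ∉ T
  neg_mem : ∀ {φ}, φ ∉ T → neg φ ∈ T

/-- Lindenbaum's lemma. -/
theorem IsTheory.exists_isMaximal {L : TenseLogic} {T : Set Formula} (hT : IsTheory L T)
    (h : bot ∉ T) : ∃ w, IsMaximal L w ∧ T ⊆ w := by
  obtain ⟨w, hTw, hw⟩ := zorn_subset_nonempty {U | IsTheory L U ∧ bot ∉ U}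
    (by
      intro c hc hchain hne
      refine ⟨⋃₀ c, ⟨⟨?_, ?_⟩, ?_⟩, fun s hs => Set.subset_sUnion_of_mem hs⟩
      · obtain ⟨U, hU⟩ := hne
        exact (hc hU).1.sub.trans (Set.subset_sUnion_of_mem hU)
      · rintro φ ψ ⟨U, hU, h₁⟩ ⟨V, hV, h₂⟩
        rcases hchain.total hU hV with h | h
        · exact ⟨V, hV, (hc hV).1.mp (h h₁) h₂⟩
        · exact ⟨U, hU, (hc hU).1.mp h₁ (h h₂)⟩
      · rintro ⟨U, hU, h⟩
        exact (hc hU).2 h) T ⟨hT, h⟩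
  refine ⟨w, ⟨hw.prop.1, hw.prop.2, ?_⟩, hTw⟩
  intro φ hφ
  by_contra hn
  -- As `neg φ` unfolds to `imp φ bot`, `hn` says that adjoining `φ` is consistent.
  have := hw.le_of_ge (y := {ψ | imp φ ψ ∈ w}) ⟨hw.prop.1.adjoin φ, hn⟩
    fun ψ hψ => hw.prop.1.taut₁ hψ fun _ a _ => a
  exact hφ (this (hw.prop.1.sub (imp_refl φ)))

namespace IsMaximal

variable {L : TenseLogic} {w : Set Formula} {φ ψ : Formula}

theorem neg_mem_iff (hw : IsMaximal L w) : neg φ ∈ w ↔ φ ∉ w :=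
  ⟨fun h h' => hw.bot_notMem (hw.mp h' h), hw.neg_mem⟩

theorem imp_mem_iff (hw : IsMaximal L w) : imp φ ψ ∈ w ↔ (φ ∈ w → ψ ∈ w) := by
  refine ⟨fun h h' => hw.mp h' h, fun h => ?_⟩
  by_cases hφ : φ ∈ w
  · exact hw.taut₁ (h hφ) fun _ a _ => a
  · exact hw.taut₁ (hw.neg_mem hφ) fun _ a b => (a b).elim

end IsMaximal

/-- The canonical accessibility relation. -/
def CanonicalR (u v : Set Formula) : Prop := ∀ χ ∈ u, pdia χ ∈ v

theorem CanonicalR.mem_of_box_mem {L : TenseLogic} {u v : Set Formula} {φ : Formula}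
    (h : CanonicalR u v) (hv : IsMaximal L v) (hφ : box φ ∈ u) : φ ∈ v :=
  hv.mp (h _ hφ) (hv.sub (pdia_box_imp φ))

theorem IsMaximal.exists_succ {L : TenseLogic} {u : Set Formula} {φ : Formula}
    (hu : IsMaximal L u) (hφ : box φ ∉ u) : ∃ v, IsMaximal L v ∧ CanonicalR u v ∧ φ ∉ v := by
  obtain ⟨v, hv, h⟩ := (hu.boxes.adjoin (neg φ)).exists_isMaximal (by
    intro h
    exact hφ (hu.mp h (hu.sub (box_mono (L.taut _ fun v => by
      simp only [neg, propEval]; tauto)))))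
  refine ⟨v, hv, fun χ hχ => h ?_, hv.neg_mem_iff.1 (h ?_)⟩
  · exact hu.mp (hu.mp hχ (hu.sub (imp_box_pdia χ)))
      (hu.sub (box_mono (L.taut _ fun _ a _ => a)))
  · exact hu.sub (nec (imp_refl _))

theorem IsMaximal.exists_pred {L : TenseLogic} {v : Set Formula} {φ : Formula}
    (hv : IsMaximal L v) (hφ : pdia φ ∈ v) : ∃ u, IsMaximal L u ∧ CanonicalR u v ∧ φ ∈ u := by
  obtain ⟨u, hu, h⟩ := (hv.pboxes.adjoin φ).exists_isMaximal (by
    intro h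
    refine hv.neg_mem_iff.1 h (hv.mp hφ (hv.sub (pdia_mono (L.taut _ fun v => ?_))))
    simp only [neg, propEval]; tauto)
  refine ⟨u, hu, fun χ hχ => ?_, h (hv.pboxes.sub (imp_refl φ))⟩
  by_contra hn
  refine (hu.neg_mem_iff (φ := χ)).1 (h ?_) hχ
  have h₁ : imp (pdia (neg (imp φ (neg χ)))) (pdia χ) ∈ L :=
    pdia_mono (L.taut _ fun v => by simp only [neg, propEval]; tauto)
  exact hv.neg_mem fun h₂ => hn (hv.mp h₂ (hv.sub h₁))

/-! ### Filtration and the finite model property -/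

/-- The transitive filtration of the canonical model through the subformulas of `φ`. -/
def filtration (L : TenseLogic) (φ : Formula) (h : ∃ w, IsMaximal L w) : Frame.{0} where
  World := {s : Set Formula // ∃ w, IsMaximal L w ∧ s = w ∩ φ.sub}
  nonempty := h.elim fun w hw => ⟨⟨_, w, hw, rfl⟩⟩
  R u v := (∀ ψ, box ψ ∈ u.1 → ψ ∈ v.1 ∧ box ψ ∈ v.1) ∧
    (∀ ψ, pdia ψ ∈ φ.sub → ψ ∈ u.1 ∨ pdia ψ ∈ u.1 → pdia ψ ∈ v.1)

section Filtration

variable {L : TenseLogic} {φ : Formula} (h : ∃ w, IsMaximal L w)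

theorem filtration_finite : Finite (filtration L φ h).World := by
  have : {s : Set Formula | ∃ w, IsMaximal L w ∧ s = w ∩ φ.sub}.Finite :=
    φ.finite_sub.powerset.subset (by rintro _ ⟨w, _, rfl⟩; exact Set.inter_subset_right)
  exact this

theorem filtration_trans {u v w : (filtration L φ h).World} (h₁ : (filtration L φ h).R u v)
    (h₂ : (filtration L φ h).R v w) : (filtration L φ h).R u w :=
  ⟨fun ψ hψ => h₂.1 ψ (h₁.1 ψ hψ).2, fun ψ hψ hu => h₂.2 ψ hψ (Or.inr (h₁.2 ψ hψ hu))⟩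

/-- The relation of the filtration is transitive by design; (4) and its past form make it contain
the image of the canonical relation. -/
theorem filtration_rel (hL : K4t ≤ L) {u v : Set Formula} (hu : IsMaximal L u)
    (hv : IsMaximal L v) (huv : CanonicalR u v) :
    (filtration L φ h).R ⟨u ∩ φ.sub, u, hu, rfl⟩ ⟨v ∩ φ.sub, v, hv, rfl⟩ := by
  refine ⟨fun ψ hψ => ⟨⟨huv.mem_of_box_mem hv hψ.1, box_arg_mem_sub hψ.2⟩,
    huv.mem_of_box_mem hv (hu.mp hψ.1 (hu.sub (box_four hL ψ))), hψ.2⟩, ?_⟩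
  rintro ψ hψ (h | h)
  · exact ⟨huv _ h.1, hψ⟩
  · exact ⟨hv.mp (huv _ h.1) (hv.sub (pdia_four hL ψ)), hψ⟩

theorem filtration_truth (hL : K4t ≤ L) (ψ : Formula) (hψ : ψ ∈ φ.sub)
    (s : (filtration L φ h).World) :
    s ∈ (filtration L φ h).eval (fun n => {s | var n ∈ s.1}) ψ ↔ ψ ∈ s.1 := by
  induction ψ generalizing s with
  | var n => exact Iff.rfl
  | bot =>
    obtain ⟨_, w, hw, rfl⟩ := s
    exact ⟨fun h => h.elim, fun h => hw.bot_notMem h.1⟩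
  | imp ψ χ h₁ h₂ =>
    rw [Frame.mem_eval_imp, h₁ (left_mem_sub hψ), h₂ (right_mem_sub hψ)]
    obtain ⟨_, w, hw, rfl⟩ := s
    have := left_mem_sub hψ
    have := right_mem_sub hψ
    have := hw.imp_mem_iff (φ := ψ) (ψ := χ)
    simp only [Set.mem_inter_iff]
    tauto
  | box ψ h₁ =>
    constructor
    · intro hs
      obtain ⟨_, w, hw, rfl⟩ := s
      refine ⟨?_, hψ⟩
      by_contra hn
      obtain ⟨v, hv, hwv, hvψ⟩ := hw.exists_succ hn
      exact hvψ ((h₁ (box_arg_mem_sub hψ) _).1 (hs _ (filtration_rel h hL hw hv hwv))).1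
    · intro hs t ht
      exact (h₁ (box_arg_mem_sub hψ) t).2 (ht.1 ψ hs).1
  | pdia ψ h₁ =>
    constructor
    · rintro ⟨t, ht, htψ⟩
      exact ht.2 ψ hψ (Or.inl ((h₁ (pdia_arg_mem_sub hψ) t).1 htψ))
    · intro hs
      obtain ⟨_, w, hw, rfl⟩ := s
      obtain ⟨v, hv, hwv, hvψ⟩ := hw.exists_pred hs.1
      exact ⟨⟨_, v, hv, rfl⟩, filtration_rel h hL hv hw hwv,
        (h₁ (pdia_arg_mem_sub hψ) _).2 ⟨hvψ, pdia_arg_mem_sub hψ⟩⟩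

end Filtration

namespace Frame

/-- Transitive frames. -/
def Trans (F : Frame.{u}) : Prop := ∀ x y z, F.R x y → F.R y z → F.R x z

/-- Points with a successor or a predecessor. -/
def Linked (F : Frame.{u}) (x : F.World) : Prop := ∃ y, F.R x y ∨ F.R y x

end Frame

/-- The finite model property of `K4t` and of its extensions by `linked`. -/
theorem exists_finite_countermodel {L : TenseLogic} (hL : K4t ≤ L) {φ : Formula} (hφ : φ ∉ L) :
    ∃ F : Frame.{0}, Finite F.World ∧ F.Trans ∧ (linked ∈ L → ∀ x, F.Linked x) ∧
      ∃ V x, x ∉ F.eval V φ := by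
  have hT : IsTheory L L.carrier := ⟨subset_rfl, fun h₁ h₂ => L.mp _ _ h₁ h₂⟩
  obtain ⟨w, hw, hnw⟩ := (hT.adjoin (neg φ)).exists_isMaximal
    fun h => hφ (mp₁ h fun v => by simp only [neg, propEval]; tauto)
  refine ⟨filtration L φ ⟨w, hw⟩, filtration_finite _, fun _ _ _ => filtration_trans _, ?_,
    fun n => {s | var n ∈ s.1}, ⟨_, w, hw, rfl⟩, ?_⟩
  · rintro h ⟨_, v, hv, rfl⟩
    -- Either a canonical successor exists, or `linked` forces a canonical predecessor; both survive
    -- the filtration.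
    by_cases hb : box bot ∈ v
    · have h₁ : pdia top ∈ v := hv.taut₂ (hv.sub h)
        (hv.mp hb (hv.sub (box_mono (ψ := neg top) (L.taut _ fun _ h => h.elim)))) fun v => by
          simp only [linked, Formula.or, dia, neg, propEval]; tauto
      obtain ⟨u, hu, huv, -⟩ := hv.exists_pred h₁
      exact ⟨_, Or.inr (filtration_rel _ hL hu hv huv)⟩
    · obtain ⟨u, hu, huv, -⟩ := hv.exists_succ hb
      exact ⟨_, Or.inl (filtration_rel _ hL hv hu huv)⟩
  · exact fun h => hw.neg_mem_iff.1 (hnw (imp_refl (neg φ)))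
      ((filtration_truth _ hL φ (mem_sub_self φ) _).1 h).1

/-! ### Formulas that describe the attached numbers -/

namespace Formula

/-- `zig k φ`: `φ` holds at a point reachable in at most `k` steps along `R` or its converse. -/
def zig : ℕ → Formula → Formula
  | 0, φ => φ
  | k + 1, φ => or (zig k φ) (or (dia (zig k φ)) (pdia (zig k φ)))

/-- `zag k φ`: `φ` holds at all points reachable in at most `k` steps. -/
def zag (k : ℕ) (φ : Formula) : Formula := neg (zig k (neg φ))

/-- There is a descending chain of `k` steps. -/
def past : ℕ → Formula
  | 0 => top
  | k + 1 => pdia (past k)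

/-- The longest descending chain has `k` steps. -/
def depth (k : ℕ) : Formula := and (past k) (neg (past (k + 1)))

/-- Nonminimal points with a serial future that see a point of depth `k`. -/
def serialAt (k : ℕ) : Formula := and (pdia top) (and (box (dia top)) (dia (depth k)))

/-- A weak Löb axiom for the past, stated at all later points. -/
def pastLob : Formula :=
  box (imp (pdia (var 0)) (pdia (and (var 0) (pbox (neg (var 0))))))

/-- `var 0` and its negation do not alternate for ever. -/
def nonAlternating : Formula :=
  neg (and (dia (var 0)) (box (imp (var 0) (dia (and (neg (var 0)) (dia (var 0)))))))

/-- Minimal points whose least visible depth is `k + 1`. -/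
def mark (k : ℕ) : Formula :=
  and (neg (pdia top)) (and (dia (depth (k + 1))) (neg (dia (depth k))))

/-- Renaming every variable `p_n` to `p_{n+1}`. -/
def shift (φ : Formula) : Formula := φ.subst fun n => var (n + 1)

/-- Modal depth. -/
def modalDepth : Formula → ℕ
  | var _ => 0
  | bot => 0
  | imp φ ψ => max (modalDepth φ) (modalDepth ψ)
  | box φ => modalDepth φ + 1
  | pdia φ => modalDepth φ + 1

end Formula

/-! ### Evaluation, connectedness and depth in Kripke frames -/

namespace Frame

section Eval

variable {F : Frame.{u}} {V : ℕ → Set F.World} {x : F.World} {φ ψ : Formula}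

@[simp] theorem mem_eval_var {n : ℕ} : x ∈ F.eval V (var n) ↔ x ∈ V n := Iff.rfl

@[simp] theorem mem_eval_imp' : x ∈ F.eval V (imp φ ψ) ↔ (x ∈ F.eval V φ → x ∈ F.eval V ψ) :=
  F.mem_eval_imp V φ ψ x

@[simp] theorem mem_eval_box : x ∈ F.eval V (box φ) ↔ ∀ y, F.R x y → y ∈ F.eval V φ := Iff.rfl

@[simp] theorem mem_eval_pdia : x ∈ F.eval V (pdia φ) ↔ ∃ y, F.R y x ∧ y ∈ F.eval V φ := Iff.rfl

@[simp] theorem mem_eval_neg : x ∈ F.eval V (neg φ) ↔ x ∉ F.eval V φ := mem_eval_imp'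

@[simp] theorem mem_eval_top : x ∈ F.eval V top := mem_eval_neg.2 id

@[simp] theorem mem_eval_or : x ∈ F.eval V (or φ ψ) ↔ x ∈ F.eval V φ ∨ x ∈ F.eval V ψ := by
  simp only [Formula.or, mem_eval_imp', mem_eval_neg]; tauto

@[simp] theorem mem_eval_and : x ∈ F.eval V (and φ ψ) ↔ x ∈ F.eval V φ ∧ x ∈ F.eval V ψ := by
  simp only [Formula.and, mem_eval_imp', mem_eval_neg]; tauto

@[simp] theorem mem_eval_dia : x ∈ F.eval V (dia φ) ↔ ∃ y, F.R x y ∧ y ∈ F.eval V φ := by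
  simp [dia]

@[simp] theorem mem_eval_pbox : x ∈ F.eval V (pbox φ) ↔ ∀ y, F.R y x → y ∈ F.eval V φ := by
  simp [pbox]

/-- `y` can be reached from `x` in at most `k` steps along `R` or its converse. -/
def Near (F : Frame.{u}) : ℕ → F.World → F.World → Prop
  | 0, x, y => x = y
  | k + 1, x, y => F.Near k x y ∨ ∃ z, (F.R x z ∨ F.R z x) ∧ F.Near k z y

theorem mem_eval_zig (k : ℕ) : x ∈ F.eval V (zig k φ) ↔ ∃ y, F.Near k x y ∧ y ∈ F.eval V φ := by
  induction k generalizing x with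
  | zero => simp [zig, Near]
  | succ k ih =>
    simp only [zig, mem_eval_or, mem_eval_dia, mem_eval_pdia, Near, ih]
    constructor
    · rintro (⟨y, h, hy⟩ | ⟨z, hz, y, h, hy⟩ | ⟨z, hz, y, h, hy⟩)
      · exact ⟨y, Or.inl h, hy⟩
      · exact ⟨y, Or.inr ⟨z, Or.inl hz, h⟩, hy⟩
      · exact ⟨y, Or.inr ⟨z, Or.inr hz, h⟩, hy⟩
    · rintro ⟨y, h | ⟨z, hz | hz, h⟩, hy⟩
      · exact Or.inl ⟨y, h, hy⟩
      · exact Or.inr (Or.inl ⟨z, hz, y, h, hy⟩)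
      · exact Or.inr (Or.inr ⟨z, hz, y, h, hy⟩)

theorem mem_eval_zag (k : ℕ) : x ∈ F.eval V (zag k φ) ↔ ∀ y, F.Near k x y → y ∈ F.eval V φ := by
  simp [zag, mem_eval_zig]

theorem eval_shift : F.eval V φ.shift = F.eval (fun n => V (n + 1)) φ := F.eval_subst V _ φ

theorem axiom4_mem_eval (h : F.Trans) : x ∈ F.eval V axiom4 := by
  simp only [axiom4, mem_eval_imp', mem_eval_box]
  exact fun h₁ y hy z hz => h₁ z (h _ _ _ hy hz)

theorem trans_of_axiom4 (h : F.Valid axiom4) : F.Trans := by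
  intro x y z hxy hyz
  exact (F.mem_eval_imp _ _ _ _).1 (h (fun _ => {w | F.R x w}) x) (fun w hw => hw) y hxy z hyz

end Eval

section Near

variable {F : Frame.{u}} {x y z : F.World} {j k : ℕ}

theorem Near.mono (h : F.Near j x y) (hjk : j ≤ k) : F.Near k x y := by
  induction k, hjk using Nat.le_induction with
  | base => exact h
  | succ k _ ih => exact Or.inl ih

theorem Near.trans (h₁ : F.Near j x y) (h₂ : F.Near k y z) : F.Near (k + j) x z := by
  induction j generalizing x with
  | zero => exact (show x = y from h₁) ▸ h₂
  | succ j ih =>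
    rcases h₁ with h₁ | ⟨w, hw, h₁⟩
    · exact Or.inl (ih h₁)
    · exact Or.inr ⟨w, hw, ih h₁⟩

theorem near_one (h : F.R x y ∨ F.R y x) : F.Near 1 x y := Or.inr ⟨y, h, rfl⟩

theorem near_one_symm (h : F.R x y ∨ F.R y x) : F.Near 1 y x := near_one h.symm

theorem Near.linked (h : F.Near k x y) (hxy : x ≠ y) : F.Linked x := by
  induction k with
  | zero => exact (hxy h).elim
  | succ k ih =>
    rcases h with h | ⟨z, hz, -⟩
    · exact ih h
    · exact ⟨z, hz⟩

theorem exists_near_bound [Finite F.World] (y : F.World) (h : ∀ x, ∃ k, F.Near k x y) :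
    ∃ k, ∀ x, F.Near k x y := by
  cases nonempty_fintype F.World
  choose f hf using h
  exact ⟨Finset.univ.sup f, fun x => (hf x).mono (Finset.le_sup (Finset.mem_univ x))⟩

theorem mem_eval_past_of_succ {V : ℕ → Set F.World} (h : x ∈ F.eval V (past (k + 1))) :
    x ∈ F.eval V (past k) := by
  induction k generalizing x with
  | zero => exact mem_eval_top
  | succ k ih =>
    obtain ⟨y, hy, h⟩ := h
    exact ⟨y, hy, ih h⟩

/-- In a finite frame no point has a large depth. -/
theorem exists_depth_bound (F : Frame.{u}) [Finite F.World] :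
    ∃ n, ∀ k, n ≤ k → ∀ V x, x ∉ F.eval V (depth k) := by
  have hV : ∀ V V' k, F.eval V (past k) = F.eval V' (past k) := by
    intro V V' k
    induction k with
    | zero => rfl
    | succ k ih => simp only [past, eval, ih]
  -- The sets where `past k` fails increase with `k`, so they stabilize in a finite frame; `hV`
  -- makes the choice of valuation irrelevant.
  obtain ⟨n, hn⟩ := WellFoundedGT.monotone_chain_condition
    (⟨fun k => (F.eval (fun _ => ∅) (past k))ᶜ, monotone_nat_of_le_succ fun k =>
      Set.compl_subset_compl.2 fun _ => mem_eval_past_of_succ⟩ : ℕ →o Set F.World)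
  refine ⟨n, fun k hk V x hx => ?_⟩
  have h := (hn k hk).symm.trans (hn (k + 1) (hk.trans (Nat.le_succ k)))
  simp only [OrderHom.coe_mk, compl_inj_iff] at h
  rw [depth, mem_eval_and, mem_eval_neg, hV V fun _ => ∅, hV V fun _ => ∅, h] at hx
  exact hx.2 hx.1

end Near

/-- No point of a transitive Kripke frame that starts a serial future validates both
`pastLob` and `nonAlternating`. -/
theorem not_pastLob_and_nonAlternating {F : Frame.{u}} (hF : F.Trans) {y : F.World}
    (h₀ : ∃ z, F.R y z) (h₁ : ∀ z, F.R y z → ∃ w, F.R z w)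
    (h₂ : ∀ V, y ∈ F.eval V pastLob) (h₃ : ∀ V, y ∈ F.eval V nonAlternating) : False := by
  have irr : ∀ z, F.R y z → ¬ F.R z z := by
    intro z hz hzz
    -- With only `z` in the valuation, the Löb axiom asks for a copy of `z` that has no `z` below
    -- it.
    have := h₂ (fun _ => {z})
    simp only [pastLob, mem_eval_box, mem_eval_imp', mem_eval_pdia, mem_eval_and, mem_eval_pbox,
      mem_eval_neg, mem_eval_var, Set.mem_singleton_iff] at this
    obtain ⟨w, -, rfl, hw⟩ := this z hz ⟨z, hzz, rfl⟩
    exact hw w hzz rfl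
  choose g hg using h₁
  obtain ⟨z₀, hz₀⟩ := h₀
  let s : ℕ → {z // F.R y z} :=
    fun n => Nat.rec ⟨z₀, hz₀⟩ (fun _ z => ⟨g z.1 z.2, hF _ _ _ z.2 (hg z.1 z.2)⟩) n
  have hs : ∀ n, F.R (s n).1 (s (n + 1)).1 := fun n => hg _ _
  have hlt : ∀ m n, m < n → F.R (s m).1 (s n).1 := by
    intro m n hmn
    induction n, hmn using Nat.le_induction with
    | base => exact hs m
    | succ n _ ih => exact hF _ _ _ ih (hs n)
  have hinj : ∀ m n, (s m).1 = (s n).1 → m = n := by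
    intro m n hmn
    by_contra hne
    rcases lt_or_gt_of_ne hne with h | h
    · exact irr _ (s n).2 (hmn ▸ hlt m n h)
    · exact irr _ (s m).2 (hmn ▸ hlt n m h)
  -- Seriality gives an ascending chain, without repetitions by irreflexivity; its even terms
  -- alternate for ever.
  have := h₃ (fun _ => {z | ∃ k, z = (s (2 * k)).1})
  simp only [nonAlternating, mem_eval_box, mem_eval_imp', mem_eval_and, mem_eval_dia,
    mem_eval_neg, mem_eval_var, Set.mem_ofPred_eq] at this
  refine this ⟨⟨_, (s 0).2, 0, rfl⟩, ?_⟩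
  rintro _ _ ⟨k, rfl⟩
  refine ⟨_, hs (2 * k), ?_, _, hs (2 * k + 1), k + 1, rfl⟩
  rintro ⟨l, hl⟩
  have := hinj (2 * k + 1) (2 * l) hl
  omega

/-! ### Local morphisms and general frames -/

/-- A map that, on the points of `D k`, preserves formulas of modal depth at most `k`. -/
structure IsLocalMorphism (G F : Frame.{0}) (D : ℕ → Set G.World) (f : G.World → F.World) :
    Prop where
  anti : ∀ k, D (k + 1) ⊆ D k
  succ_mem : ∀ k, ∀ x ∈ D (k + 1), ∀ y, G.R x y → y ∈ D k ∧ F.R (f x) (f y)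
  pred_mem : ∀ k, ∀ x ∈ D (k + 1), ∀ y, G.R y x → y ∈ D k ∧ F.R (f y) (f x)
  exists_succ : ∀ k, ∀ x ∈ D (k + 1), ∀ z, F.R (f x) z → ∃ y, G.R x y ∧ f y = z
  exists_pred : ∀ k, ∀ x ∈ D (k + 1), ∀ z, F.R z (f x) → ∃ y, G.R y x ∧ f y = z

/-- Each modal operator costs one step, that is, one level of `D`. Confining the valuation to `D 0`
is harmless here and later makes it admissible. -/
theorem IsLocalMorphism.mem_eval {G F : Frame.{0}} {D : ℕ → Set G.World}
    {f : G.World → F.World} (h : IsLocalMorphism G F D f) (V : ℕ → Set F.World) (φ : Formula)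
    {k : ℕ} (hk : φ.modalDepth ≤ k) {x : G.World} (hx : x ∈ D k) :
    x ∈ G.eval (fun n => {w | w ∈ D 0 ∧ f w ∈ V n}) φ ↔ f x ∈ F.eval V φ := by
  have hD : ∀ k, D k ⊆ D 0 := by
    intro k
    induction k with
    | zero => exact subset_rfl
    | succ k ih => exact (h.anti k).trans ih
  induction φ generalizing k x with
  | var n => exact and_iff_right (hD k hx)
  | bot => exact Iff.rfl
  | imp φ ψ h₁ h₂ =>
    exact (mem_eval_imp _ _ _ _ _).trans ((imp_congr (h₁ ((le_max_left _ _).trans hk) hx)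
      (h₂ ((le_max_right _ _).trans hk) hx)).trans (mem_eval_imp _ _ _ _ _).symm)
  | box φ ih =>
    obtain ⟨k, rfl⟩ : ∃ j, k = j + 1 := ⟨k - 1, by simp only [modalDepth] at hk; omega⟩
    have hk' : φ.modalDepth ≤ k := by simp only [modalDepth] at hk; omega
    simp only [mem_eval_box]
    constructor
    · intro hb z hz
      obtain ⟨y, hy, rfl⟩ := h.exists_succ k x hx z hz
      exact (ih hk' (h.succ_mem k x hx y hy).1).1 (hb y hy)
    · intro hb y hy
      obtain ⟨h₁, h₂⟩ := h.succ_mem k x hx y hy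
      exact (ih hk' h₁).2 (hb _ h₂)
  | pdia φ ih =>
    obtain ⟨k, rfl⟩ : ∃ j, k = j + 1 := ⟨k - 1, by simp only [modalDepth] at hk; omega⟩
    have hk' : φ.modalDepth ≤ k := by simp only [modalDepth] at hk; omega
    simp only [mem_eval_pdia]
    constructor
    · rintro ⟨y, hy, hb⟩
      obtain ⟨h₁, h₂⟩ := h.pred_mem k x hx y hy
      exact ⟨_, h₂, (ih hk' h₁).1 hb⟩
    · rintro ⟨z, hz, hb⟩
      obtain ⟨y, hy, rfl⟩ := h.exists_pred k x hx z hz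
      exact ⟨y, hy, (ih hk' (h.pred_mem k x hx y hy).1).2 hb⟩

/-- Families of sets that form a general frame over `F`. -/
structure IsAdmissible (F : Frame.{0}) (A : Set (Set F.World)) : Prop where
  bot : ∅ ∈ A
  imp : ∀ S ∈ A, ∀ T ∈ A, Sᶜ ∪ T ∈ A
  box : ∀ S ∈ A, {x | ∀ y, F.R x y → y ∈ S} ∈ A
  pdia : ∀ S ∈ A, {x | ∃ y, F.R y x ∧ y ∈ S} ∈ A

theorem IsAdmissible.eval_mem {F : Frame.{0}} {A : Set (Set F.World)} (hA : F.IsAdmissible A)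
    {V : ℕ → Set F.World} (hV : ∀ n, V n ∈ A) (φ : Formula) : F.eval V φ ∈ A := by
  induction φ with
  | var n => exact hV n
  | bot => exact hA.bot
  | imp φ ψ h₁ h₂ => exact hA.imp _ h₁ _ h₂
  | box φ h => exact hA.box _ h
  | pdia φ h => exact hA.pdia _ h

/-- The logic of a general frame. -/
def generalLog (F : Frame.{0}) (A : Set (Set F.World)) (hA : F.IsAdmissible A) : TenseLogic where
  carrier := {φ | ∀ V : ℕ → Set F.World, (∀ n, V n ∈ A) → ∀ x, x ∈ F.eval V φ}
  taut φ h V _ x := (F.propEval_iff V x φ).1 (h _)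
  adj φ ψ := by
    constructor
    · intro h V hV x
      rw [mem_eval_imp]
      intro hx y hxy
      exact (F.mem_eval_imp V _ _ y).1 (h V hV y) ⟨x, hxy, hx⟩
    · intro h V hV y
      rw [mem_eval_imp]
      rintro ⟨x, hxy, hx⟩
      exact (F.mem_eval_imp V _ _ x).1 (h V hV x) hx y hxy
  mp φ ψ h₁ h₂ V hV x := (F.mem_eval_imp V φ ψ x).1 (h₂ V hV x) (h₁ V hV x)
  subst s φ h V hV x := by
    rw [eval_subst]
    exact h _ (fun n => hA.eval_mem hV (s n)) x

end Frame

/-! ### Attaching the natural numbers to a finite base -/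

namespace Frame

/-- A finite transitive frame that is connected to a point without predecessors. -/
structure IsBase (K : Frame.{0}) (s : K.World) : Prop where
  finite : Finite K.World
  trans : K.Trans
  no_pred : ∀ u, ¬ K.R u s
  near : ∀ u, ∃ k, K.Near k u s

/-- The frame `K` together with a copy of `(ℕ, <)`, of which `s` sees the numbers from `i` on. -/
def addNat (K : Frame.{0}) (s : K.World) (i : ℕ) : Frame.{0} where
  World := K.World ⊕ ℕ
  nonempty := ⟨Sum.inr 0⟩
  R
    | .inl u, .inl v => K.R u v
    | .inl u, .inr m => u = s ∧ i ≤ m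
    | .inr _, .inl _ => False
    | .inr m, .inr m' => m < m'

section AddNat

variable {K : Frame.{0}} {s : K.World} {i : ℕ}

/-- A point of the base as a point of `addNat`. -/
def base (i : ℕ) (u : K.World) : (K.addNat s i).World := Sum.inl u

/-- A number as a point of `addNat`. -/
def nat (K : Frame.{0}) (s : K.World) (i m : ℕ) : (K.addNat s i).World := Sum.inr m

theorem addNat_cases (w : (K.addNat s i).World) : (∃ u, w = base i u) ∨ ∃ m, w = nat K s i m := by
  rcases w with u | m
  · exact Or.inl ⟨u, rfl⟩
  · exact Or.inr ⟨m, rfl⟩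

theorem base_rel_base {u v : K.World} :
    (K.addNat s i).R (base i u) (base i v) ↔ K.R u v := Iff.rfl

theorem base_rel_nat {u : K.World} {m : ℕ} :
    (K.addNat s i).R (base i u) (nat K s i m) ↔ u = s ∧ i ≤ m := Iff.rfl

theorem nat_rel_nat {m m' : ℕ} :
    (K.addNat s i).R (nat K s i m) (nat K s i m') ↔ m < m' := Iff.rfl

theorem rel_base_iff {w : (K.addNat s i).World} {u : K.World} :
    (K.addNat s i).R w (base i u) ↔ ∃ v, K.R v u ∧ w = base i v := by
  rcases addNat_cases w with ⟨v, rfl⟩ | ⟨m, rfl⟩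
  · exact ⟨fun h => ⟨v, h, rfl⟩, fun ⟨v', h, e⟩ => by cases e; exact h⟩
  · exact ⟨fun h => h.elim, fun ⟨_, _, e⟩ => by cases e⟩

theorem nat_rel_iff {w : (K.addNat s i).World} {m : ℕ} :
    (K.addNat s i).R (nat K s i m) w ↔ ∃ m', m < m' ∧ w = nat K s i m' := by
  rcases addNat_cases w with ⟨v, rfl⟩ | ⟨m', rfl⟩
  · exact ⟨fun h => h.elim, fun ⟨_, _, e⟩ => by cases e⟩
  · exact ⟨fun h => ⟨m', h, rfl⟩, fun ⟨v', h, e⟩ => by cases e; exact h⟩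

theorem rel_nat_iff {w : (K.addNat s i).World} {m : ℕ} :
    (K.addNat s i).R w (nat K s i m) ↔
      (∃ m', m' < m ∧ w = nat K s i m') ∨ (w = base i s ∧ i ≤ m) := by
  rcases addNat_cases w with ⟨v, rfl⟩ | ⟨m', rfl⟩
  · constructor
    · rintro ⟨rfl, h⟩
      exact Or.inr ⟨rfl, h⟩
    · rintro (⟨_, _, e⟩ | ⟨e, h⟩)
      · cases e
      · cases e
        exact ⟨rfl, h⟩
  · constructor
    · exact fun h => Or.inl ⟨m', h, rfl⟩
    · rintro (⟨_, h, e⟩ | ⟨e, h⟩)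
      · cases e
        exact h
      · cases e

theorem addNat_trans (hK : K.IsBase s) : (K.addNat s i).Trans := by
  intro x y z hxy hyz
  rcases x with x | x <;> rcases y with y | y <;> rcases z with z | z
  · exact hK.trans _ _ _ hxy hyz
  · obtain ⟨rfl, -⟩ := hyz
    exact (hK.no_pred _ hxy).elim
  · exact hyz.elim
  · exact ⟨hxy.1, hxy.2.trans (le_of_lt hyz)⟩
  · exact hxy.elim
  · exact hxy.elim
  · exact hyz.elim
  · exact lt_trans (α := ℕ) hxy hyz

/-- The sets that are eventually constant on the numbers. -/
def evConst (K : Frame.{0}) (s : K.World) (i : ℕ) : Set (Set (K.addNat s i).World) :=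
  {S | ∃ n, (∀ m, n ≤ m → nat K s i m ∈ S) ∨ (∀ m, n ≤ m → nat K s i m ∉ S)}

/-- A tail inside `S` stays inside its box and a tail outside `S` stays outside. For the past
operator any `S` will do: once a number has a predecessor in `S`, so has every larger one. -/
theorem isAdmissible_evConst : (K.addNat s i).IsAdmissible (evConst K s i) where
  bot := ⟨0, Or.inr fun _ _ h => h⟩
  imp := by
    rintro S ⟨n₁, h₁⟩ T ⟨n₂, h₂⟩
    refine ⟨max n₁ n₂, ?_⟩
    rcases h₂ with h₂ | h₂
    · exact Or.inl fun m hm => Or.inr (h₂ m (le_of_max_le_right hm))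
    rcases h₁ with h₁ | h₁
    · refine Or.inr fun m hm => ?_
      rintro (h | h)
      · exact h (h₁ m (le_of_max_le_left hm))
      · exact h₂ m (le_of_max_le_right hm) h
    · exact Or.inl fun m hm => Or.inl (h₁ m (le_of_max_le_left hm))
  box := by
    rintro S ⟨n, h | h⟩
    · refine ⟨n, Or.inl fun m hm y hy => ?_⟩
      obtain ⟨m', hm', rfl⟩ := nat_rel_iff.1 hy
      exact h m' (hm.trans hm'.le)
    · exact ⟨n, Or.inr fun m hm hb =>
        h (m + 1) (hm.trans m.le_succ) (hb _ (nat_rel_nat.2 m.lt_succ_self))⟩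
  pdia := by
    rintro S -
    by_cases h : ∃ y m₀, (K.addNat s i).R y (nat K s i m₀) ∧ y ∈ S
    · obtain ⟨y, m₀, hy, hS⟩ := h
      refine ⟨m₀, Or.inl fun m hm => ⟨y, ?_, hS⟩⟩
      rcases rel_nat_iff.1 hy with ⟨m', h, rfl⟩ | ⟨rfl, h⟩
      · exact nat_rel_nat.2 (h.trans_le hm)
      · exact base_rel_nat.2 ⟨rfl, h.trans hm⟩
    · exact ⟨0, Or.inr fun m _ ⟨y, hy, hS⟩ => h ⟨y, m, hy, hS⟩⟩

/-- The logic of the general frame of eventually constant sets over `addNat`. -/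
def addNatLog (K : Frame.{0}) (s : K.World) (i : ℕ) : TenseLogic :=
  (K.addNat s i).generalLog (evConst K s i) isAdmissible_evConst

theorem K4t_le_addNatLog (hK : K.IsBase s) : K4t ≤ addNatLog K s i :=
  K4t_le fun _ _ _ => axiom4_mem_eval (addNat_trans hK)

theorem near_base {k : ℕ} {u v : K.World} (h : K.Near k u v) :
    (K.addNat s i).Near k (base i u) (base i v) := by
  induction k generalizing u with
  | zero => exact congrArg _ h
  | succ k ih =>
    rcases h with h | ⟨z, hz, h⟩
    · exact Or.inl (ih h)
    · exact Or.inr ⟨base i z, hz, ih h⟩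

theorem near_nat_base (m : ℕ) : (K.addNat s i).Near 2 (nat K s i m) (base i s) :=
  Near.trans (near_one (y := nat K s i (max i (m + 1)))
    (Or.inl (nat_rel_nat.2 (lt_of_lt_of_le m.lt_succ_self (le_max_right _ _)))))
    (near_one (Or.inr (base_rel_nat.2 ⟨rfl, le_max_left _ _⟩)))

theorem near_base_nat (m : ℕ) : (K.addNat s i).Near 2 (base i s) (nat K s i m) :=
  Near.trans (near_one (y := nat K s i (max i (m + 1)))
    (Or.inl (base_rel_nat.2 ⟨rfl, le_max_left _ _⟩)))
    (near_one (Or.inr (nat_rel_nat.2 (lt_of_lt_of_le m.lt_succ_self (le_max_right _ _)))))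

/-- The bound must not depend on `i`, since one formula has to serve all the frames at once. Any
number and `s` have a common successor, which costs two steps each way. -/
theorem exists_near_addNat (hK : K.IsBase s) : ∃ d, ∀ i, ∀ w : (K.addNat s i).World,
    (K.addNat s i).Near d w (base i s) ∧ ∀ m, (K.addNat s i).Near d w (nat K s i m) := by
  have := hK.finite
  obtain ⟨d, hd⟩ := exists_near_bound s hK.near
  refine ⟨d + 4, fun i w => ?_⟩
  have h : (K.addNat s i).Near (d + 2) w (base i s) := by
    rcases addNat_cases w with ⟨u, rfl⟩ | ⟨m, rfl⟩
    · exact (near_base (hd u)).mono (by omega)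
    · exact (near_nat_base m).mono (by omega)
  exact ⟨h.mono (by omega), fun m => (h.trans (near_base_nat m)).mono (by omega)⟩

theorem linked_mem_addNatLog (hK : K.IsBase s) : linked ∈ addNatLog K s i := by
  intro V _ x
  obtain ⟨d, hd⟩ := exists_near_addNat hK
  obtain ⟨y, hy | hy⟩ : (K.addNat s i).Linked x := by
    by_cases hx : x = base i s
    · exact ((hd i x).2 0).linked (by rw [hx]; intro e; cases e)
    · exact (hd i x).1.linked hx
  · exact mem_eval_or.2 (Or.inl (mem_eval_dia.2 ⟨y, hy, mem_eval_top⟩))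
  · exact mem_eval_or.2 (Or.inr ⟨y, hy, mem_eval_top⟩)

section Depth

variable {V : ℕ → Set (K.addNat s i).World}

/-- The base is closed under predecessors and `past` only looks backwards. -/
theorem base_mem_eval_past {u : K.World} {k : ℕ} :
    base i u ∈ (K.addNat s i).eval V (past k) ↔ u ∈ K.eval (fun _ => ∅) (past k) := by
  induction k generalizing u with
  | zero => simp [past]
  | succ k ih =>
    simp only [past, mem_eval_pdia, rel_base_iff]
    constructor
    · rintro ⟨_, ⟨v, hv, rfl⟩, h⟩
      exact ⟨v, hv, ih.1 h⟩
    · rintro ⟨v, hv, h⟩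
      exact ⟨_, ⟨v, hv, rfl⟩, ih.2 h⟩

theorem root_mem_eval_past (hK : K.IsBase s) {k : ℕ} :
    base i s ∈ (K.addNat s i).eval V (past k) ↔ k = 0 := by
  cases k with
  | zero => simp [past]
  | succ k =>
    simp only [past, mem_eval_pdia, rel_base_iff, Nat.succ_ne_zero, iff_false]
    rintro ⟨_, ⟨v, hv, -⟩, -⟩
    exact hK.no_pred v hv

/-- The point `s` has depth 0, and by `1 ≤ i` it lies only below positive numbers, so it lengthens
no descending chain. -/
theorem nat_mem_eval_past (hK : K.IsBase s) (hi : 1 ≤ i) {m k : ℕ} :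
    nat K s i m ∈ (K.addNat s i).eval V (past k) ↔ k ≤ m := by
  induction k generalizing m with
  | zero => simp [past]
  | succ k ih =>
    simp only [past, mem_eval_pdia, rel_nat_iff]
    constructor
    · rintro ⟨_, ⟨m', hm, rfl⟩ | ⟨rfl, hm⟩, h⟩
      · exact (Nat.succ_le_succ (ih.1 h)).trans hm
      · rw [(root_mem_eval_past hK).1 h]
        exact hi.trans hm
    · exact fun h => ⟨_, Or.inl ⟨k, h, rfl⟩, ih.2 le_rfl⟩

theorem nat_mem_eval_depth (hK : K.IsBase s) (hi : 1 ≤ i) {m k : ℕ} :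
    nat K s i m ∈ (K.addNat s i).eval V (depth k) ↔ k = m := by
  rw [depth, mem_eval_and, mem_eval_neg, nat_mem_eval_past hK hi, nat_mem_eval_past hK hi]
  omega

theorem base_notMem_eval_depth {k : ℕ} (hk : ∀ V x, x ∉ K.eval V (depth k)) (u : K.World) :
    base i u ∉ (K.addNat s i).eval V (depth k) := by
  have := hk (fun _ => ∅) u
  rwa [depth, mem_eval_and, mem_eval_neg, ← base_mem_eval_past (i := i) (s := s) (V := V),
    ← base_mem_eval_past (i := i) (s := s) (V := V), ← mem_eval_neg, ← mem_eval_and] at this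

theorem nat_mem_eval_dia_depth (hK : K.IsBase s) (hi : 1 ≤ i) {m k : ℕ} :
    nat K s i m ∈ (K.addNat s i).eval V (dia (depth k)) ↔ m < k := by
  simp only [mem_eval_dia, nat_rel_iff]
  constructor
  · rintro ⟨_, ⟨m', hm, rfl⟩, h⟩
    rwa [(nat_mem_eval_depth hK hi).1 h]
  · exact fun h => ⟨_, ⟨k, h, rfl⟩, (nat_mem_eval_depth hK hi).2 rfl⟩

theorem base_mem_eval_dia_depth (hK : K.IsBase s) (hi : 1 ≤ i) {k : ℕ}
    (hk : ∀ V x, x ∉ K.eval V (depth k)) {u : K.World} :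
    base i u ∈ (K.addNat s i).eval V (dia (depth k)) ↔ u = s ∧ i ≤ k := by
  simp only [mem_eval_dia]
  constructor
  · rintro ⟨w, hw, h⟩
    rcases addNat_cases w with ⟨v, rfl⟩ | ⟨m, rfl⟩
    · exact (base_notMem_eval_depth hk v h).elim
    · rwa [(nat_mem_eval_depth hK hi).1 h]
  · exact fun h => ⟨nat K s i k, base_rel_nat.2 h, (nat_mem_eval_depth hK hi).2 rfl⟩

/-- At depths absent from `K`, the point `s` sees exactly those from `i` on, so the least one
reveals `i`. -/
theorem mem_eval_mark (hK : K.IsBase s) (hi : 1 ≤ i) {k : ℕ}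
    (hk : ∀ V x, x ∉ K.eval V (depth k)) (hk' : ∀ V x, x ∉ K.eval V (depth (k + 1)))
    {w : (K.addNat s i).World} :
    w ∈ (K.addNat s i).eval V (mark k) ↔ w = base i s ∧ i = k + 1 := by
  rw [mark, mem_eval_and, mem_eval_and, mem_eval_neg, mem_eval_neg]
  rcases addNat_cases w with ⟨u, rfl⟩ | ⟨m, rfl⟩
  · rw [base_mem_eval_dia_depth hK hi hk, base_mem_eval_dia_depth hK hi hk']
    constructor
    · rintro ⟨-, ⟨rfl, h₁⟩, h₂⟩
      exact ⟨rfl, le_antisymm h₁ (not_le.1 fun h => h₂ ⟨rfl, h⟩)⟩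
    · rintro ⟨e, h⟩
      cases e
      exact ⟨mt (root_mem_eval_past hK (k := 1)).1 one_ne_zero, ⟨rfl, h.le⟩, by omega⟩
  · rw [nat_mem_eval_dia_depth hK hi, nat_mem_eval_dia_depth hK hi]
    constructor
    · rintro ⟨h₀, h₁, h₂⟩
      have : ¬ 1 ≤ m := fun h => h₀ ((nat_mem_eval_past hK hi (k := 1)).2 h)
      -- Only the number 0 remains, and it would need `k = 0`; but `s` itself has depth 0 in `K`.
      have hk₀ : k = 0 := by omega
      subst hk₀
      refine (hk (fun _ => ∅) s ?_).elim
      rw [depth, mem_eval_and, mem_eval_neg]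
      refine ⟨mem_eval_top, ?_⟩
      rintro ⟨y, hy, -⟩
      exact hK.no_pred y hy
    · rintro ⟨e, -⟩
      cases e

/-- Among base points only `s` sees depth `k`, and `s` has no predecessor. -/
theorem mem_eval_serialAt (hK : K.IsBase s) (hi : 1 ≤ i) {k : ℕ}
    (hk : ∀ V x, x ∉ K.eval V (depth k)) {w : (K.addNat s i).World}
    (hw : w ∈ (K.addNat s i).eval V (serialAt k)) : ∃ m, w = nat K s i m := by
  rw [serialAt, mem_eval_and, mem_eval_and] at hw
  rcases addNat_cases w with ⟨u, rfl⟩ | h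
  · obtain ⟨rfl, -⟩ := (base_mem_eval_dia_depth hK hi hk).1 hw.2.2
    exact (one_ne_zero ((root_mem_eval_past hK (k := 1)).1 hw.1)).elim
  · exact h

theorem one_mem_eval_serialAt (hK : K.IsBase s) (hi : 1 ≤ i) {k : ℕ} (hk : 2 ≤ k) :
    nat K s i 1 ∈ (K.addNat s i).eval V (serialAt k) := by
  rw [serialAt, mem_eval_and, mem_eval_and]
  refine ⟨(nat_mem_eval_past hK hi (k := 1)).2 le_rfl, ?_, (nat_mem_eval_dia_depth hK hi).2 hk⟩
  intro y hy
  obtain ⟨m, -, rfl⟩ := nat_rel_iff.1 hy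
  exact mem_eval_dia.2 ⟨_, nat_rel_nat.2 m.lt_succ_self, mem_eval_top⟩

/-- The past of a number is well-founded: the required witness is `s` if it qualifies, and otherwise
the least number that does. No admissibility is needed. -/
theorem nat_mem_eval_pastLob (hK : K.IsBase s) (m : ℕ) :
    nat K s i m ∈ (K.addNat s i).eval V pastLob := by
  simp only [pastLob, mem_eval_box, mem_eval_imp', mem_eval_pdia, mem_eval_and, mem_eval_pbox,
    mem_eval_neg, mem_eval_var]
  intro y hy hex
  obtain ⟨l, -, rfl⟩ := nat_rel_iff.1 hy
  by_cases hs : base i s ∈ V 0 ∧ i ≤ l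
  · refine ⟨_, base_rel_nat.2 ⟨rfl, hs.2⟩, hs.1, ?_⟩
    intro z hz
    obtain ⟨v, hv, -⟩ := rel_base_iff.1 hz
    exact (hK.no_pred v hv).elim
  have hex' : ∃ j, j < l ∧ nat K s i j ∈ V 0 := by
    obtain ⟨z, hz, hzV⟩ := hex
    rcases rel_nat_iff.1 hz with ⟨j, hj, rfl⟩ | ⟨rfl, h⟩
    · exact ⟨j, hj, hzV⟩
    · exact (hs ⟨hzV, h⟩).elim
  classical
  obtain ⟨h₁, h₂⟩ := Nat.find_spec hex'
  refine ⟨_, nat_rel_nat.2 h₁, h₂, ?_⟩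
  intro z hz hzV
  rcases rel_nat_iff.1 hz with ⟨j, hj, rfl⟩ | ⟨rfl, h⟩
  · exact Nat.find_min hex' hj ⟨hj.trans h₁, hzV⟩
  · exact hs ⟨hzV, h.trans h₁.le⟩

/-- Here admissibility is essential: failure would put `V 0` and its complement cofinally often on
the numbers. -/
theorem nat_mem_eval_nonAlternating (hV : V 0 ∈ evConst K s i) (m : ℕ) :
    nat K s i m ∈ (K.addNat s i).eval V nonAlternating := by
  simp only [nonAlternating, mem_eval_box, mem_eval_imp', mem_eval_and, mem_eval_dia,
    mem_eval_neg, mem_eval_var]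
  rintro ⟨⟨y, hy, hyV⟩, hstep⟩
  obtain ⟨l, hl, rfl⟩ := nat_rel_iff.1 hy
  have step : ∀ j, m < j → nat K s i j ∈ V 0 → ∃ j₁ j₂, j < j₁ ∧ j₁ < j₂ ∧
      nat K s i j₁ ∉ V 0 ∧ nat K s i j₂ ∈ V 0 := by
    intro j hj hjV
    obtain ⟨z, hz, hzV, z', hz', hzV'⟩ := hstep _ (nat_rel_nat.2 hj) hjV
    obtain ⟨j₁, h₁, rfl⟩ := nat_rel_iff.1 hz
    obtain ⟨j₂, h₂, rfl⟩ := nat_rel_iff.1 hz'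
    exact ⟨j₁, j₂, h₁, h₂, hzV, hzV'⟩
  have unb : ∀ n, ∃ j, n ≤ j ∧ m < j ∧ nat K s i j ∈ V 0 := by
    intro n
    induction n with
    | zero => exact ⟨l, Nat.zero_le _, hl, hyV⟩
    | succ n ih =>
      obtain ⟨j, hnj, hmj, hj⟩ := ih
      obtain ⟨j₁, j₂, h₁, h₂, -, h₃⟩ := step j hmj hj
      exact ⟨j₂, by omega, by omega, h₃⟩
  obtain ⟨n, hn⟩ := hV
  obtain ⟨j, hnj, hmj, hj⟩ := unb n
  obtain ⟨j₁, j₂, h₁, h₂, h₃, h₄⟩ := step j hmj hj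
  rcases hn with hn | hn
  · exact h₃ (hn j₁ (by omega))
  · exact hn j hnj hj

end Depth

theorem zig_serialAt_mem (hK : K.IsBase s) (hi : 1 ≤ i) {d k : ℕ} (hk : 2 ≤ k)
    (hd : ∀ w : (K.addNat s i).World, ∀ m, (K.addNat s i).Near d w (nat K s i m)) :
    zig d (serialAt k) ∈ addNatLog K s i :=
  fun _ _ w => (mem_eval_zig d).2 ⟨_, hd w 1, one_mem_eval_serialAt hK hi hk⟩

theorem zag_pastLob_mem (hK : K.IsBase s) (hi : 1 ≤ i) {k : ℕ}
    (hk : ∀ V x, x ∉ K.eval V (depth k)) (d : ℕ) :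
    zag d (imp (serialAt k) pastLob) ∈ addNatLog K s i := by
  refine fun V _ w => (mem_eval_zag d).2 fun y _ => mem_eval_imp'.2 fun h => ?_
  obtain ⟨m, rfl⟩ := mem_eval_serialAt hK hi hk h
  exact nat_mem_eval_pastLob hK m

theorem zag_nonAlternating_mem (hK : K.IsBase s) (hi : 1 ≤ i) {k : ℕ}
    (hk : ∀ V x, x ∉ K.eval V (depth k)) (d : ℕ) :
    zag d (imp (serialAt k) nonAlternating) ∈ addNatLog K s i := by
  refine fun V hV w => (mem_eval_zag d).2 fun y _ => mem_eval_imp'.2 fun h => ?_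
  obtain ⟨m, rfl⟩ := mem_eval_serialAt hK hi hk h
  exact nat_mem_eval_nonAlternating (hV 0) m

end AddNat

/-- Adding three formulas, relative to `α`, does not exclude any Kripke frame of `α`. -/
theorem mem_eval_of_incomplete {F : Frame.{u}} (hF : F.Trans) {α : Formula} {d k : ℕ}
    (h₁ : F.Valid (or α.shift (zig d (serialAt k))))
    (h₂ : F.Valid (or α.shift (zag d (imp (serialAt k) pastLob))))
    (h₃ : F.Valid (or α.shift (zag d (imp (serialAt k) nonAlternating)))) : F.Valid α := by
  intro V x
  by_contra hx
  -- Since `α` is shifted, variable 0 is free: `V` goes on refuting `α` while `S` ranges over all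
  -- values for the two axioms.
  let W : Set F.World → ℕ → Set F.World := fun S n => Nat.casesOn n S V
  have hW : ∀ S ψ, x ∈ F.eval (W S) (or α.shift ψ) → x ∈ F.eval (W S) ψ := by
    intro S ψ h
    rcases mem_eval_or.1 h with h | h
    · rw [eval_shift] at h
      exact (hx h).elim
    · exact h
  obtain ⟨y, hxy, hy⟩ := (mem_eval_zig d).1 (hW ∅ _ (h₁ _ x))
  have hpast : ∀ S T : ℕ → Set F.World, ∀ k, F.eval S (past k) = F.eval T (past k) := by
    intro S T k
    induction k with
    | zero => rfl
    | succ k ih => simp only [past, eval, ih]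
  -- `serialAt k` has no variables, so the same `y` serves every valuation.
  have hser : ∀ S T : ℕ → Set F.World, y ∈ F.eval S (serialAt k) → y ∈ F.eval T (serialAt k) := by
    intro S T h
    simp only [serialAt, depth, mem_eval_and, mem_eval_neg, mem_eval_dia, mem_eval_box,
      mem_eval_pdia, mem_eval_top, hpast S T] at h ⊢
    exact h
  have hy' := hy
  simp only [serialAt, mem_eval_and, mem_eval_dia, mem_eval_box, mem_eval_top, and_true] at hy'
  have hvar : ∀ S : Set F.World, ∀ V', V' 0 = S → F.eval V' (var 0) = F.eval (W S) (var 0) :=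
    fun S V' h => h
  refine not_pastLob_and_nonAlternating hF (y := y) (hy'.2.2.imp fun _ h => h.1) hy'.2.1 ?_ ?_
  · intro V'
    have := mem_eval_imp'.1 ((mem_eval_zag d).1 (hW (V' 0) _ (h₂ _ x)) y hxy) (hser _ _ hy)
    simp only [pastLob, mem_eval_box, mem_eval_imp', mem_eval_pdia, mem_eval_and, mem_eval_pbox,
      mem_eval_neg, hvar (V' 0) V' rfl] at this ⊢
    exact this
  · intro V'
    have := mem_eval_imp'.1 ((mem_eval_zag d).1 (hW (V' 0) _ (h₃ _ x)) y hxy) (hser _ _ hy)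
    simp only [nonAlternating, mem_eval_box, mem_eval_imp', mem_eval_dia, mem_eval_and,
      mem_eval_neg, hvar (V' 0) V' rfl] at this ⊢
    exact this

end Frame

/-! ### The zigzag of copies of a finite frame -/

namespace Frame

/-- `n + 1` copies of `F`, joined in a zigzag along the edge from `a` to `b`, and a new point
below the last copy of `b`. -/
def zigzag (F : Frame.{0}) (a b : F.World) (n : ℕ) : Frame.{0} where
  World := Option (Fin (n + 1) × F.World)
  nonempty := ⟨none⟩
  R
    | some (k, x), some (l, y) => (k = l ∧ F.R x y) ∨
        (Even k.1 ∧ (l.1 = k.1 + 1 ∨ k.1 = l.1 + 1) ∧ (x = a ∨ F.R x a) ∧ (y = b ∨ F.R b y))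
    | none, some (l, y) => l.1 = n ∧ (y = b ∨ F.R b y)
    | _, none => False

section Zigzag

variable {F : Frame.{0}} {a b : F.World} {n : ℕ}

/-- The point `x` of the `k`-th copy. -/
def copy (a b : F.World) (k : Fin (n + 1)) (x : F.World) : (F.zigzag a b n).World := some (k, x)

/-- The least point. -/
def root (a b : F.World) (n : ℕ) : (F.zigzag a b n).World := none

theorem zigzag_cases (w : (F.zigzag a b n).World) :
    w = root a b n ∨ ∃ k x, w = copy a b k x := by
  rcases w with _ | ⟨k, x⟩
  · exact Or.inl rfl
  · exact Or.inr ⟨k, x, rfl⟩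

theorem copy_rel_copy {k l : Fin (n + 1)} {x y : F.World} :
    (F.zigzag a b n).R (copy a b k x) (copy a b l y) ↔ (k = l ∧ F.R x y) ∨
      (Even k.1 ∧ (l.1 = k.1 + 1 ∨ k.1 = l.1 + 1) ∧ (x = a ∨ F.R x a) ∧ (y = b ∨ F.R b y)) :=
  Iff.rfl

theorem root_rel_copy {l : Fin (n + 1)} {y : F.World} :
    (F.zigzag a b n).R (root a b n) (copy a b l y) ↔ l.1 = n ∧ (y = b ∨ F.R b y) := Iff.rfl

theorem not_rel_root (w : (F.zigzag a b n).World) : ¬ (F.zigzag a b n).R w (root a b n) := by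
  rcases w with _ | ⟨k, x⟩ <;> exact id

/-- Edges between copies run from even to odd copies, so no two of them compose. As `n` is odd, no
such edge leaves the last copy, the only one that the root sees. -/
theorem zigzag_trans (hF : F.Trans) (hn : Odd n) : (F.zigzag a b n).Trans := by
  have up : ∀ y z, (y = b ∨ F.R b y) → F.R y z → z = b ∨ F.R b z := by
    rintro y z (rfl | h) hyz
    · exact Or.inr hyz
    · exact Or.inr (hF _ _ _ h hyz)
  have down : ∀ x y, F.R x y → (y = a ∨ F.R y a) → x = a ∨ F.R x a := by
    rintro x y hxy (rfl | h)
    · exact Or.inr hxy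
    · exact Or.inr (hF _ _ _ hxy h)
  intro u v w huv hvw
  rcases zigzag_cases w with rfl | ⟨m, z, rfl⟩
  · exact (not_rel_root _ hvw).elim
  rcases zigzag_cases v with rfl | ⟨l, y, rfl⟩
  · exact (not_rel_root _ huv).elim
  rcases zigzag_cases u with rfl | ⟨k, x, rfl⟩
  · rw [root_rel_copy] at huv ⊢
    rcases copy_rel_copy.1 hvw with ⟨rfl, h⟩ | ⟨h, -⟩
    · exact ⟨huv.1, up _ _ huv.2 h⟩
    · rw [huv.1] at h
      exact (Nat.not_even_iff_odd.2 hn h).elim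
  · rw [copy_rel_copy] at huv hvw ⊢
    rcases huv with ⟨rfl, h₁⟩ | ⟨h₁, h₂, h₃, h₄⟩
    · rcases hvw with ⟨rfl, h₂⟩ | ⟨h₂, h₃, h₄, h₅⟩
      · exact Or.inl ⟨rfl, hF _ _ _ h₁ h₂⟩
      · exact Or.inr ⟨h₂, h₃, down _ _ h₁ h₄, h₅⟩
    · rcases hvw with ⟨rfl, h₅⟩ | ⟨h₅, -⟩
      · exact Or.inr ⟨h₁, h₂, h₃, up _ _ h₄ h₅⟩
      · exfalso
        rw [Nat.even_iff] at h₁ h₅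
        omega

theorem near_copy {k : Fin (n + 1)} {j : ℕ} {x y : F.World} (h : F.Near j x y) :
    (F.zigzag a b n).Near j (copy a b k x) (copy a b k y) := by
  induction j generalizing x with
  | zero => exact congrArg _ h
  | succ j ih =>
    rcases h with h | ⟨z, hz, h⟩
    · exact Or.inl (ih h)
    · exact Or.inr ⟨copy a b k z, hz.imp (fun h => Or.inl ⟨rfl, h⟩) (fun h => Or.inl ⟨rfl, h⟩),
        ih h⟩

theorem exists_near_root (hab : F.R a b) (hconn : ∀ x, ∃ k, F.Near k x a)
    (w : (F.zigzag a b n).World) : ∃ j, (F.zigzag a b n).Near j w (root a b n) := by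
  have key : ∀ i (k : Fin (n + 1)), k.1 + i = n → ∀ x, ∃ j,
      (F.zigzag a b n).Near j (copy a b k x) (root a b n) := by
    intro i
    induction i with
    | zero =>
      intro k hk x
      obtain ⟨j, hj⟩ := hconn x
      exact ⟨_, (near_copy (hj.trans (near_one (Or.inl hab)))).trans
        (near_one (Or.inr (root_rel_copy.2 ⟨hk, Or.inl rfl⟩)))⟩
    | succ i ih =>
      intro k hk x
      obtain ⟨j, hj⟩ := hconn x
      let l : Fin (n + 1) := ⟨k.1 + 1, by omega⟩
      by_cases he : Even k.1
      · obtain ⟨m, hm⟩ := ih l (by simp only [l]; omega) b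
        exact ⟨_, ((near_copy hj).trans (near_one (Or.inl (copy_rel_copy.2
          (Or.inr ⟨he, Or.inl rfl, Or.inl rfl, Or.inl rfl⟩))))).trans hm⟩
      · obtain ⟨m, hm⟩ := ih l (by simp only [l]; omega) a
        exact ⟨_, ((near_copy (hj.trans (near_one (Or.inl hab)))).trans
          (near_one (Or.inr (copy_rel_copy.2 (Or.inr ⟨Nat.even_add_one.2 he, Or.inr rfl,
            Or.inl rfl, Or.inl rfl⟩))))).trans hm⟩
  rcases zigzag_cases w with rfl | ⟨k, x, rfl⟩
  · exact ⟨0, rfl⟩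
  · exact key (n - k.1) k (by omega) x

theorem isBase_zigzag [Finite F.World] (hF : F.Trans) (hn : Odd n) (hab : F.R a b)
    (hconn : ∀ x, ∃ k, F.Near k x a) : (F.zigzag a b n).IsBase (root a b n) where
  finite := inferInstanceAs (Finite (Option (Fin (n + 1) × F.World)))
  trans := zigzag_trans hF hn
  no_pred := not_rel_root
  near := exists_near_root hab hconn

/-- The copies of index at most `n - j`. -/
def firstCopies (a b : F.World) (n i j : ℕ) :
    Set ((F.zigzag a b n).addNat (root a b n) i).World :=
  {w | ∃ k x, w = base i (copy a b k x) ∧ k.1 + j ≤ n}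

/-- The projection to `F`. -/
def project (a b : F.World) (n i : ℕ) :
    ((F.zigzag a b n).addNat (root a b n) i).World → F.World
  | Sum.inl (some (_, x)) => x
  | _ => a

/-- A step changes the index of the copy by at most one, and only the last copy touches the root. An
edge between copies projects to an edge of `F` through `a` and `b` by transitivity. -/
theorem isLocalMorphism_project (hF : F.Trans) (hab : F.R a b) (i : ℕ) :
    IsLocalMorphism ((F.zigzag a b n).addNat (root a b n) i) F (firstCopies a b n i)
      (project a b n i) where
  anti := by
    rintro j _ ⟨k, x, rfl, h⟩
    exact ⟨k, x, rfl, by omega⟩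
  succ_mem := by
    rintro j _ ⟨k, x, rfl, hk⟩ w hw
    rcases addNat_cases w with ⟨v, rfl⟩ | ⟨m, rfl⟩
    · rcases zigzag_cases v with rfl | ⟨l, y, rfl⟩
      · exact (not_rel_root _ (base_rel_base.1 hw)).elim
      rcases copy_rel_copy.1 (base_rel_base.1 hw) with ⟨rfl, h⟩ | ⟨-, h, h₁, h₂⟩
      · exact ⟨⟨k, y, rfl, by omega⟩, h⟩
      · refine ⟨⟨l, y, rfl, by omega⟩, show F.R x y from ?_⟩
        rcases h₁ with rfl | h₁ <;> rcases h₂ with rfl | h₂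
        · exact hab
        · exact hF _ _ _ hab h₂
        · exact hF _ _ _ h₁ hab
        · exact hF _ _ _ h₁ (hF _ _ _ hab h₂)
    · cases (base_rel_nat.1 hw).1
  pred_mem := by
    rintro j _ ⟨k, x, rfl, hk⟩ w hw
    obtain ⟨v, hv, rfl⟩ := rel_base_iff.1 hw
    rcases zigzag_cases v with rfl | ⟨l, y, rfl⟩
    · have := (root_rel_copy.1 hv).1
      omega
    rcases copy_rel_copy.1 hv with ⟨rfl, h⟩ | ⟨-, h, h₁, h₂⟩
    · exact ⟨⟨l, y, rfl, by omega⟩, h⟩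
    · refine ⟨⟨l, y, rfl, by omega⟩, show F.R y x from ?_⟩
      rcases h₁ with rfl | h₁ <;> rcases h₂ with rfl | h₂
      · exact hab
      · exact hF _ _ _ hab h₂
      · exact hF _ _ _ h₁ hab
      · exact hF _ _ _ h₁ (hF _ _ _ hab h₂)
  exists_succ := by
    rintro j _ ⟨k, x, rfl, hk⟩ z hz
    exact ⟨base i (copy a b k z), Or.inl ⟨rfl, hz⟩, rfl⟩
  exists_pred := by
    rintro j _ ⟨k, x, rfl, hk⟩ z hz
    exact ⟨base i (copy a b k z), Or.inl ⟨rfl, hz⟩, rfl⟩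

theorem exists_evConst_countermodel (hF : F.Trans) (hab : F.R a b) {φ : Formula}
    (hn : φ.modalDepth ≤ n) {V : ℕ → Set F.World} {x : F.World} (hx : x ∉ F.eval V φ) (i : ℕ) :
    ∃ W : ℕ → Set ((F.zigzag a b n).addNat (root a b n) i).World,
      (∀ m, W m ∈ evConst (F.zigzag a b n) (root a b n) i) ∧
      ∃ w, w ∉ ((F.zigzag a b n).addNat (root a b n) i).eval W φ := by
  refine ⟨_, fun m => ⟨0, Or.inr ?_⟩, base i (copy a b 0 x), fun h => hx
    (((isLocalMorphism_project hF hab i).mem_eval V φ hn ⟨0, x, rfl, by simp⟩).1 h)⟩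
  rintro l - ⟨⟨k, y, e, -⟩, -⟩
  cases e

end Zigzag

/-! ### Components, change of universe and isolated points -/

/-- The subframe of the points connected to `x`. -/
def component (F : Frame.{0}) (x : F.World) : Frame.{0} where
  World := {y // ∃ k, F.Near k y x}
  nonempty := ⟨⟨x, 0, rfl⟩⟩
  R y z := F.R y.1 z.1

theorem near_component {F : Frame.{0}} {x : F.World} {k : ℕ} {y : F.World} (h : F.Near k y x) :
    (F.component x).Near k ⟨y, k, h⟩ ⟨x, 0, rfl⟩ := by
  induction k generalizing y with
  | zero => exact Subtype.ext h
  | succ k ih =>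
    rcases h with h | ⟨z, hz, h⟩
    · exact Or.inl (ih h)
    · exact Or.inr ⟨⟨z, k, h⟩, hz, ih h⟩

theorem mem_eval_component {F : Frame.{0}} {x : F.World} (V : ℕ → Set F.World) (φ : Formula)
    (y : (F.component x).World) :
    y ∈ (F.component x).eval (fun n => {y | y.1 ∈ V n}) φ ↔ y.1 ∈ F.eval V φ := by
  have h : IsLocalMorphism (F.component x) F (fun _ => Set.univ) Subtype.val :=
    { anti := fun _ => subset_rfl
      succ_mem := fun _ _ _ _ h => ⟨trivial, h⟩
      pred_mem := fun _ _ _ _ h => ⟨trivial, h⟩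
      exists_succ := fun _ y _ z hz => ⟨⟨z, y.2.elim fun k hk => ⟨k + 1, Or.inr ⟨_, Or.inr hz, hk⟩⟩⟩,
        hz, rfl⟩
      exists_pred := fun _ y _ z hz => ⟨⟨z, y.2.elim fun k hk => ⟨k + 1, Or.inr ⟨_, Or.inl hz, hk⟩⟩⟩,
        hz, rfl⟩ }
  have := h.mem_eval V φ (k := φ.modalDepth) le_rfl (x := y) trivial
  simpa only [Set.mem_univ, true_and] using this

/-- A formula refuted at a linked point of a finite transitive frame is refuted in general frames
over `addNat`. -/
theorem exists_base {F : Frame.{0}} [Finite F.World] (hF : F.Trans) {φ : Formula}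
    {V : ℕ → Set F.World} {x : F.World} (hx : x ∉ F.eval V φ) (hlink : F.Linked x) :
    ∃ (K : Frame.{0}) (s : K.World), K.IsBase s ∧ ∀ i,
      ∃ W : ℕ → Set (K.addNat s i).World, (∀ m, W m ∈ evConst K s i) ∧
        ∃ w, w ∉ (K.addNat s i).eval W φ := by
  let C := F.component x
  have : Finite C.World := inferInstanceAs (Finite {y // ∃ k, F.Near k y x})
  have hC : C.Trans := fun _ _ _ h₁ h₂ => hF _ _ _ h₁ h₂
  let x' : C.World := ⟨x, 0, rfl⟩
  have hx' : x' ∉ C.eval (fun n => {y | y.1 ∈ V n}) φ := fun h =>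
    hx ((mem_eval_component V φ x').1 h)
  have hconn : ∀ y : C.World, ∃ k, C.Near k y x' := fun y => y.2.imp fun k hk => near_component hk
  obtain ⟨a, b, hab, ha⟩ : ∃ a b : C.World, C.R a b ∧ ∀ y, ∃ k, C.Near k y a := by
    obtain ⟨y, hy⟩ := hlink
    have hy' : F.Near 1 y x := near_one_symm hy
    rcases hy with hy | hy
    · exact ⟨x', ⟨y, 1, hy'⟩, hy, hconn⟩
    · refine ⟨⟨y, 1, hy'⟩, x', hy, fun z => ?_⟩
      obtain ⟨k, hk⟩ := hconn z
      exact ⟨_, hk.trans (near_one (Or.inr hy))⟩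
  -- The length is odd, for transitivity, and at least the modal depth, so that copy 0 cannot notice
  -- the root.
  exact ⟨_, _, isBase_zigzag (n := 2 * φ.modalDepth + 1) hC ⟨_, rfl⟩ hab ha,
    exists_evConst_countermodel hC hab (by omega) hx'⟩

/-- A copy of a frame in a higher universe. -/
def lift (F : Frame.{0}) : Frame.{u} where
  World := ULift.{u} F.World
  nonempty := F.nonempty.map ULift.up
  R x y := F.R x.down y.down

theorem mem_eval_lift {F : Frame.{0}} (V : ℕ → Set (lift.{u} F).World) (φ : Formula)
    (x : (lift.{u} F).World) :
    x ∈ (lift.{u} F).eval V φ ↔ x.down ∈ F.eval (fun n => {y | ULift.up y ∈ V n}) φ := by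
  induction φ generalizing x with
  | var n => exact Iff.rfl
  | bot => exact Iff.rfl
  | imp φ ψ h₁ h₂ =>
    exact (mem_eval_imp _ _ _ _ _).trans ((imp_congr (h₁ x) (h₂ x)).trans
      (mem_eval_imp _ _ _ _ _).symm)
  | box φ h => exact ⟨fun hb y hy => (h ⟨y⟩).1 (hb ⟨y⟩ hy), fun hb y hy => (h y).2 (hb y.down hy)⟩
  | pdia φ h =>
    exact ⟨fun ⟨y, hy, hb⟩ => ⟨y.down, hy, (h y).1 hb⟩, fun ⟨y, hy, hb⟩ => ⟨⟨y⟩, hy, (h ⟨y⟩).2 hb⟩⟩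

theorem lift_valid {F : Frame.{0}} {φ : Formula} : (lift.{u} F).Valid φ ↔ F.Valid φ := by
  constructor
  · intro h V x
    have := (mem_eval_lift _ φ (ULift.up x)).1 (h (fun n => {y | y.down ∈ V n}) (ULift.up x))
    exact this
  · exact fun h V x => (mem_eval_lift V φ x).2 (h _ _)

/-- At an isolated point formulas behave as in `•`. -/
theorem mem_eval_bullet_iff {F : Frame.{0}} {x : F.World} (hx : ¬ F.Linked x)
    (V : ℕ → Set F.World) (φ : Formula) :
    () ∈ bullet.eval (fun n => {_y | x ∈ V n}) φ ↔ x ∈ F.eval V φ := by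
  induction φ with
  | var n => exact Iff.rfl
  | bot => exact Iff.rfl
  | imp φ ψ h₁ h₂ =>
    exact (mem_eval_imp _ _ _ _ _).trans ((imp_congr h₁ h₂).trans (mem_eval_imp _ _ _ _ _).symm)
  | box φ h => exact ⟨fun _ y hy => (hx ⟨y, Or.inl hy⟩).elim, fun _ _ hy => hy.elim⟩
  | pdia φ h => exact ⟨fun ⟨_, hy, _⟩ => hy.elim, fun ⟨y, hy, _⟩ => (hx ⟨y, Or.inr hy⟩).elim⟩

theorem K4t_le_log {F : Frame.{u}} (hF : F.Trans) : K4t ≤ F.log :=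
  K4t_le fun _ _ => axiom4_mem_eval hF

end Frame

open Tense.Frame

/-! ### The splitting by the irreflexive point -/

/-- `K4t` extended by the axiom that every point is linked; this is `K4t/Log(•)`. -/
def K4tLinked : TenseLogic := oplus K4t {linked}

theorem K4t_le_K4tLinked : K4t ≤ K4tLinked := le_oplus _ _

theorem linked_mem_K4tLinked : linked ∈ K4tLinked := mem_oplus_of_mem rfl

theorem K4tLinked_le {L : TenseLogic} (hL : K4t ≤ L) (h : linked ∈ L) : K4tLinked ≤ L :=
  oplus_le hL fun _ hφ => Set.mem_singleton_iff.1 hφ ▸ h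

theorem linked_notMem_log_bullet : linked ∉ bullet.log := by
  intro h
  rcases mem_eval_or.1 (h (fun _ => ∅) ()) with h | ⟨_, h, -⟩
  · obtain ⟨_, h, -⟩ := mem_eval_dia.1 h
    exact h
  · exact h

theorem linked_mem_log {F : Frame.{u}} (h : ∀ x, F.Linked x) : linked ∈ F.log := by
  intro V x
  obtain ⟨y, hy | hy⟩ := h x
  · exact mem_eval_or.2 (Or.inl (mem_eval_dia.2 ⟨y, hy, mem_eval_top⟩))
  · exact mem_eval_or.2 (Or.inr ⟨y, hy, mem_eval_top⟩)

/-- Without `linked`, every box is true and every past possibility false, so a formula with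
constants for variables is decided as in `•`. -/
theorem linked_or_mem {L : TenseLogic} (V : ℕ → Set bullet.World) (o : bullet.World) (s : ℕ → Formula)
    (hs : ∀ n, (o ∈ V n → s n = top) ∧ (o ∉ V n → s n = bot)) (φ : Formula) :
    (o ∈ bullet.eval V φ → or linked (φ.subst s) ∈ L) ∧
      (o ∉ bullet.eval V φ → or linked (neg (φ.subst s)) ∈ L) := by
  induction φ with
  | var n =>
    refine ⟨fun h => ?_, fun h => ?_⟩
    · simp only [Formula.subst, (hs n).1 h]
      exact L.taut _ fun v => by simp only [Formula.or, top, neg, propEval]; tauto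
    · simp only [Formula.subst, (hs n).2 h]
      exact L.taut _ fun v => by simp only [Formula.or, neg, propEval]; tauto
  | bot =>
    exact ⟨fun h => h.elim, fun _ => L.taut _ fun v => by
      simp only [Formula.or, Formula.subst, neg, propEval]; tauto⟩
  | imp φ ψ h₁ h₂ =>
    rw [mem_eval_imp]
    refine ⟨fun h => ?_, fun h => ?_⟩
    · by_cases hφ : o ∈ bullet.eval V φ
      · exact mp₁ (h₂.1 (h hφ)) fun v => by
          simp only [Formula.or, Formula.subst, neg, propEval]; tauto
      · exact mp₁ (h₁.2 hφ) fun v => by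
          simp only [Formula.or, Formula.subst, neg, propEval]; tauto
    · rw [Classical.not_imp] at h
      exact mp₂ (h₁.1 h.1) (h₂.2 h.2) fun v => by
        simp only [Formula.or, Formula.subst, neg, propEval]; tauto
  | box φ _ =>
    refine ⟨fun _ => ?_, fun h => (h fun _ hy => hy.elim).elim⟩
    have : imp (box (neg top)) (box (φ.subst s)) ∈ L :=
      box_mono (L.taut _ fun v => by simp only [top, neg, propEval]; tauto)
    exact mp₁ this fun v => by
      simp only [linked, dia, Formula.or, Formula.subst, neg, propEval]; tauto
  | pdia φ _ =>
    refine ⟨fun ⟨_, hy, _⟩ => hy.elim, fun _ => ?_⟩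
    have : imp (pdia (φ.subst s)) (pdia top) ∈ L :=
      pdia_mono (L.taut _ fun v => by simp only [top, neg, propEval]; tauto)
    exact mp₁ this fun v => by
      simp only [linked, dia, Formula.or, Formula.subst, neg, propEval]; tauto

theorem isSplittingPair_bullet : IsSplittingPair K4t bullet.log K4tLinked := by
  refine ⟨K4t_le_log fun _ _ _ h => h.elim, K4t_le_K4tLinked, fun L hL => ?_⟩
  by_cases h : L ≤ bullet.log
  · exact Or.inl ⟨h, fun h' => linked_notMem_log_bullet (h (h' linked_mem_K4tLinked))⟩
  · refine Or.inr ⟨K4tLinked_le hL ?_, h⟩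
    simp only [le_iff, not_forall] at h
    obtain ⟨φ, hφ, hn⟩ := h
    obtain ⟨V, o, hV⟩ : ∃ V x, x ∉ bullet.eval V φ := by
      by_contra! hc
      exact hn hc
    classical
    let s : ℕ → Formula := fun n => if o ∈ V n then top else bot
    have hs : ∀ n, (o ∈ V n → s n = top) ∧ (o ∉ V n → s n = bot) :=
      fun n => ⟨fun h => if_pos h, fun h => if_neg h⟩
    exact mp₂ ((linked_or_mem V o s hs φ).2 hV) (L.subst s φ hφ) fun v => by
      simp only [Formula.or, neg, propEval]; tauto

/-- Every proper extension of `K4t` other than `K4tLinked` is refuted at a linked point of a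
finite transitive frame. -/
theorem exists_linked_countermodel {L : TenseLogic} (hL : K4t ≤ L) (h₁ : L ≠ K4t)
    (h₂ : L ≠ K4tLinked) : ∃ φ ∈ L, ∃ F : Frame.{0}, Finite F.World ∧ F.Trans ∧
      (K4tLinked ≤ L → ∀ x, F.Linked x) ∧ ∃ V x, x ∉ F.eval V φ ∧ F.Linked x := by
  by_cases h : L ≤ K4tLinked
  · have h₃ : ¬ K4tLinked ≤ L := fun h' => h₂ (le_antisymm h h')
    have h₄ : L ≤ bullet.log := ((isSplittingPair_bullet.2.2 L hL).resolve_right fun h' => h₃ h'.1).1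
    have h₅ : ¬ L ≤ K4t := fun h' => h₁ (le_antisymm h' hL)
    simp only [le_iff, not_forall] at h₅
    obtain ⟨φ, hφ, hn⟩ := h₅
    obtain ⟨F, hfin, hF, -, V, x, hx⟩ := exists_finite_countermodel le_rfl hn
    refine ⟨φ, hφ, F, hfin, hF, fun h' => (h₃ h').elim, V, x, hx, ?_⟩
    -- An isolated refuting point would refute `φ` in `•`, whose logic contains `L`.
    by_contra hl
    exact hx ((mem_eval_bullet_iff hl V φ).1 (h₄ hφ _ _))
  · simp only [le_iff, not_forall] at h
    obtain ⟨φ, hφ, hn⟩ := h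
    obtain ⟨F, hfin, hF, hl, V, x, hx⟩ := exists_finite_countermodel K4t_le_K4tLinked hn
    exact ⟨φ, hφ, F, hfin, hF, fun _ => hl linked_mem_K4tLinked, V, x, hx,
      hl linked_mem_K4tLinked x⟩

/-! ### Continuum many logics with the same frames -/

/-- An injective numbering of the formulas. -/
def Formula.code : Formula → ℕ
  | var n => 5 * n
  | bot => 1
  | imp φ ψ => 5 * Nat.pair φ.code ψ.code + 2
  | box φ => 5 * φ.code + 3
  | pdia φ => 5 * φ.code + 4

theorem Formula.code_injective : Function.Injective code := by
  intro φ
  induction φ with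
  | var n =>
    intro ψ h
    cases ψ <;> simp only [code] at h
    case var m => exact congrArg var (by omega)
    all_goals omega
  | bot => intro ψ h; cases ψ <;> simp only [code] at h <;> first | rfl | omega
  | imp φ χ h₁ h₂ =>
    intro ψ h
    cases ψ <;> simp only [code] at h
    case imp φ' χ' =>
      obtain ⟨h₃, h₄⟩ := Nat.pair_eq_pair.1 (by omega : Nat.pair φ.code χ.code = Nat.pair φ'.code χ'.code)
      rw [h₁ h₃, h₂ h₄]
    all_goals omega
  | box φ ih =>
    intro ψ h
    cases ψ <;> simp only [code] at h
    case box φ' => exact congrArg box (ih (by omega))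
    all_goals omega
  | pdia φ ih =>
    intro ψ h
    cases ψ <;> simp only [code] at h
    case pdia φ' => exact congrArg pdia (ih (by omega))
    all_goals omega

theorem mk_tenseLogic_le : Cardinal.mk TenseLogic ≤ 2 ^ Cardinal.aleph0 := by
  have h₁ : Cardinal.mk TenseLogic ≤ Cardinal.mk (Set Formula) :=
    Cardinal.mk_le_of_injective (f := TenseLogic.carrier) fun _ _ h => TenseLogic.ext h
  have : Countable Formula := Formula.code_injective.countable
  rw [Cardinal.mk_set] at h₁
  exact h₁.trans (Cardinal.power_le_power_left two_ne_zero Cardinal.mk_le_aleph0)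

theorem deg_le (L₀ L : TenseLogic) : deg.{u} L₀ L ≤ 2 ^ Cardinal.aleph0 :=
  (Cardinal.mk_subtype_le _).trans mk_tenseLogic_le

theorem df_le (L₀ L : TenseLogic) : df.{u} L₀ L ≤ 2 ^ Cardinal.aleph0 :=
  (Cardinal.mk_subtype_le _).trans mk_tenseLogic_le

theorem finFr_eq_of_fr_eq {L M : TenseLogic} (h : Fr.{u} L = Fr.{u} M) :
    FinFr.{u} L = FinFr.{u} M := by
  ext F
  exact and_congr_right fun _ => (Set.ext_iff.1 h F : F ∈ Fr L ↔ F ∈ Fr M)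

theorem deg_le_df (L₀ L : TenseLogic) : deg.{u} L₀ L ≤ df.{u} L₀ L :=
  Cardinal.mk_le_of_injective
    (f := fun M => ⟨M.1, M.2.1, finFr_eq_of_fr_eq M.2.2⟩)
    fun _ _ h => Subtype.ext (congrArg (fun M => M.1) h)

theorem deg_eq_of_ne {L : TenseLogic} (hL : K4t ≤ L) (h₁ : L ≠ K4t) (h₂ : L ≠ K4tLinked) :
    deg.{u} K4t L = 2 ^ Cardinal.aleph0 := by
  refine le_antisymm (deg_le _ _) ?_
  obtain ⟨φ, hφ, F, hfin, hF, -, V, x, hx, hlink⟩ := exists_linked_countermodel hL h₁ h₂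
  obtain ⟨K, s, hK, hcm⟩ := exists_base hF hx hlink
  have := hK.finite
  obtain ⟨N, hN⟩ := K.exists_depth_bound
  obtain ⟨d, hd⟩ := exists_near_addNat hK
  -- The offset `N + 1` makes the attachment index positive and keeps the depths used by the marks
  -- out of `K`.
  let M : Set ℕ → TenseLogic :=
    fun I => sInf ({L} ∪ {L' | ∃ i ∈ I, L' = addNatLog K s (N + i + 1)})
  have hML : ∀ I, M I ≤ L := fun I ψ h => h L (Or.inl rfl)
  have hM : ∀ I, M I ∈ NExt K4t := by
    rintro I ψ hψ L' (rfl | ⟨i, -, rfl⟩)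
    · exact hL hψ
    · exact K4t_le_addNatLog hK hψ
  have hor : ∀ I α β, α ∈ L → (∀ i, β ∈ addNatLog K s (N + i + 1)) → or α β ∈ M I := by
    rintro I α β hα hβ L' (rfl | ⟨i, -, rfl⟩)
    · exact mp₁ hα fun v => by simp only [Formula.or, neg, propEval]; tauto
    · exact mp₁ (hβ i) fun v => by simp only [Formula.or, neg, propEval]; tauto
  have hFr : ∀ I, Fr.{u} (M I) = Fr.{u} L := by
    intro I
    ext G
    refine ⟨fun hG α hα => ?_, fun hG ψ hψ => hG ψ (hML I hψ)⟩
    have hα' : α.shift ∈ L := L.subst _ _ hα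
    have hN' : ∀ V x, x ∉ K.eval V (depth (N + 2)) := hN _ (by omega)
    -- Depth `N + 2` does not occur in `K` and is at least 2, so the number 1 sees it.
    refine mem_eval_of_incomplete (d := d) (k := N + 2)
      (trans_of_axiom4 (hG _ (hM I (mem_oplus_of_mem rfl)))) (hG _ (hor I _ _ hα' fun i => ?_))
      (hG _ (hor I _ _ hα' fun i => ?_)) (hG _ (hor I _ _ hα' fun i => ?_))
    · exact zig_serialAt_mem hK (by omega) (by omega) fun w => (hd _ w).2
    · exact zag_pastLob_mem hK (by omega) hN' d
    · exact zag_nonAlternating_mem hK (by omega) hN' d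
  -- The disjunct `φ` puts the formula into `L`. In the general frame for `i` a valuation refutes
  -- `φ`, and the mark at `s`, within distance `d`, refutes the other disjunct.
  have hmark : ∀ I i, or φ (zag d (neg (mark (N + i)))) ∈ M I ↔ i ∉ I := by
    intro I i
    constructor
    · intro h hi
      obtain ⟨W, hW, w, hw⟩ := hcm (N + i + 1)
      rcases mem_eval_or.1 (h _ (Or.inr ⟨i, hi, rfl⟩) W hW w) with h | h
      · exact hw h
      · exact mem_eval_neg.1 ((mem_eval_zag d).1 h _ (hd _ w).1)
          ((mem_eval_mark hK (by omega) (hN _ (by omega)) (hN _ (by omega))).2 ⟨rfl, rfl⟩)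
    · rintro hi L' (rfl | ⟨j, hj, rfl⟩)
      · exact mp₁ hφ fun v => by simp only [Formula.or, neg, propEval]; tauto
      · intro W hW w
        refine mem_eval_or.2 (Or.inr ((mem_eval_zag d).2 fun y _ => mem_eval_neg.2 fun h => hi ?_))
        have := ((mem_eval_mark hK (by omega) (hN _ (by omega)) (hN _ (by omega))).1 h).2
        rwa [show i = j by omega]
  have hinj : Function.Injective
      (fun I => (⟨M I, hM I, hFr I⟩ : {L' // L' ∈ NExt K4t ∧ Fr.{u} L' = Fr.{u} L})) := by
    intro I J h
    have h' : M I = M J := congrArg Subtype.val h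
    ext i
    rw [← not_iff_not, ← hmark I i, ← hmark J i, h']
  have := Cardinal.mk_le_of_injective hinj
  rwa [Cardinal.mk_set, Cardinal.mk_nat] at this

theorem df_eq_of_ne {L : TenseLogic} (hL : K4t ≤ L) (h₁ : L ≠ K4t) (h₂ : L ≠ K4tLinked) :
    df.{u} K4t L = 2 ^ Cardinal.aleph0 :=
  le_antisymm (df_le _ _) ((deg_eq_of_ne hL h₁ h₂).symm.le.trans (deg_le_df _ _))

/-! ### Degree one and the absence of further splittings -/

/-- Logics with the finite model property are determined from above by their finite frames. -/
theorem le_of_finFr_subset {L M : TenseLogic} (hL : L = K4t ∨ L = K4tLinked)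
    (h : FinFr.{u} L ⊆ FinFr.{u} M) : M ≤ L := by
  intro φ hφ
  by_contra hn
  have hKL : K4t ≤ L := by
    rcases hL with rfl | rfl
    exacts [le_rfl, K4t_le_K4tLinked]
  obtain ⟨F, hfin, hF, hl, V, x, hx⟩ := exists_finite_countermodel hKL hn
  have hLF : L ≤ F.log := by
    rcases hL with rfl | rfl
    · exact K4t_le_log hF
    · exact K4tLinked_le (K4t_le_log hF) (linked_mem_log (hl linked_mem_K4tLinked))
  have hmem : lift.{u} F ∈ FinFr.{u} L :=
    ⟨inferInstanceAs (Finite (ULift F.World)), fun ψ hψ => lift_valid.2 (hLF hψ)⟩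
  exact hx (lift_valid.1 ((h hmem).2 φ hφ) V x)

/-- For `K4tLinked` the lower bound uses the splitting: otherwise `•` would be a finite frame of
`M`. -/
theorem eq_of_finFr_eq {L M : TenseLogic} (hL : L = K4t ∨ L = K4tLinked) (hM : K4t ≤ M)
    (h : FinFr.{u} M = FinFr.{u} L) : M = L := by
  refine le_antisymm (le_of_finFr_subset hL h.ge) ?_
  rcases hL with rfl | rfl
  · exact hM
  rcases isSplittingPair_bullet.2.2 M hM with ⟨h', -⟩ | ⟨h', -⟩
  · have hmem : lift.{u} bullet ∈ FinFr.{u} M :=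
      ⟨inferInstanceAs (Finite (ULift Unit)), fun ψ hψ => lift_valid.2 (h' hψ)⟩
    rw [h] at hmem
    exact (linked_notMem_log_bullet (lift_valid.1 (hmem.2 _ linked_mem_K4tLinked))).elim
  · exact h'

theorem df_eq_one {L : TenseLogic} (hL : L = K4t ∨ L = K4tLinked) (h : K4t ≤ L) :
    df.{u} K4t L = 1 := by
  rw [df, Cardinal.eq_one_iff_unique]
  exact ⟨⟨fun M N => Subtype.ext ((eq_of_finFr_eq hL M.2.1 M.2.2).trans
    (eq_of_finFr_eq hL N.2.1 N.2.2).symm)⟩, ⟨⟨L, h, rfl⟩⟩⟩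

theorem deg_eq_one {L : TenseLogic} (hL : L = K4t ∨ L = K4tLinked) (h : K4t ≤ L) :
    deg.{u} K4t L = 1 := by
  rw [deg, Cardinal.eq_one_iff_unique]
  exact ⟨⟨fun M N => Subtype.ext ((eq_of_finFr_eq hL M.2.1 (finFr_eq_of_fr_eq M.2.2)).trans
    (eq_of_finFr_eq hL N.2.1 (finFr_eq_of_fr_eq N.2.2)).symm)⟩, ⟨⟨L, h, rfl⟩⟩⟩

/-- The only splittings of `NExt(K4t)` and `NExt(K4tLinked)`. -/
theorem eq_of_isSplittingPair {L₀ L₁ L₂ : TenseLogic} (h₀ : L₀ = K4t ∨ L₀ = K4tLinked)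
    (h : IsSplittingPair L₀ L₁ L₂) : L₂ = K4t ∨ L₂ = K4tLinked := by
  obtain ⟨-, h₂, hsplit⟩ := h
  have hext : ∀ {L}, K4t ≤ L → (L₀ = K4tLinked → linked ∈ L) → L ∈ NExt L₀ := by
    intro L hL hl
    rcases h₀ with rfl | rfl
    exacts [hL, K4tLinked_le hL (hl rfl)]
  have hK : K4t ≤ L₂ := by
    rcases h₀ with rfl | rfl
    exacts [h₂, K4t_le_K4tLinked.trans h₂]
  by_contra! hne
  obtain ⟨φ, hφ, F, hfin, hF, hFl, V, x, hx, hlink⟩ := exists_linked_countermodel hK hne.1 hne.2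
  obtain ⟨K, s, hbase, hcm⟩ := exists_base hF hx hlink
  have := hbase.finite
  -- The bound is for `F`, not for the base: `F` must refute what the general frame validates.
  obtain ⟨N, hN⟩ := F.exists_depth_bound
  obtain ⟨d, hd⟩ := exists_near_addNat hbase
  have h₃ : F.log ≤ L₁ := by
    refine ((hsplit F.log (hext (K4t_le_log hF) ?_)).resolve_right fun h => ?_).1
    · rintro rfl
      exact linked_mem_log (hFl h₂)
    · exact hx (h.1 hφ V x)
  have h₄ : addNatLog K s 1 ≤ L₁ := by
    refine ((hsplit _ (hext (K4t_le_addNatLog hbase) fun _ =>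
      linked_mem_addNatLog hbase)).resolve_right fun h => ?_).1
    obtain ⟨W, hW, w, hw⟩ := hcm 1
    exact hw (h.1 hφ W hW w)
  have h₅ : zig d (serialAt (N + 2)) ∈ L₁ :=
    h₄ (zig_serialAt_mem hbase le_rfl (by omega) fun w => (hd _ w).2)
  have h₆ : neg (zig d (serialAt (N + 2))) ∈ L₁ := h₃ fun V x => by
    rw [mem_eval_neg, mem_eval_zig]
    rintro ⟨y, -, hy⟩
    obtain ⟨z, -, hz⟩ := mem_eval_dia.1 (mem_eval_and.1 (mem_eval_and.1 hy).2).2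
    exact hN _ (by omega) V z hz
  -- `L₁` contains a formula and its negation, hence lies above `L₂`, against the splitting
  -- condition.
  have h₇ : ∀ L : TenseLogic, L ≤ L₁ := fun L ψ _ => mp₂ h₅ h₆ fun _ a b => (b a).elim
  rcases hsplit L₂ h₂ with h | h
  · exact h.2 le_rfl
  · exact h.2 (h₇ _)

theorem eq_of_isIteratedSplitting {L : TenseLogic} (h : IsIteratedSplitting K4t L) :
    L = K4t ∨ L = K4tLinked := by
  induction h with
  | base => exact Or.inl rfl
  | step _ _ _ _ h ih => exact eq_of_isSplittingPair ih h

theorem eq_of_isUnionSplitting {L : TenseLogic} (h : IsUnionSplitting K4t L) :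
    L = K4t ∨ L = K4tLinked := by
  obtain ⟨S, hS, rfl⟩ := h
  have hS' : ∀ M ∈ S, M = K4t ∨ M = K4tLinked :=
    fun M hM => (hS M hM).elim fun _ h => eq_of_isSplittingPair (Or.inl rfl) h
  by_cases h : K4tLinked ∈ S
  · refine Or.inr (le_antisymm (sup_le K4t_le_K4tLinked (sSup_le fun M hM => ?_))
      (le_sup_of_le_right (le_sSup h)))
    rcases hS' M hM with rfl | rfl
    exacts [K4t_le_K4tLinked, le_rfl]
  · refine Or.inl (le_antisymm (sup_le le_rfl (sSup_le fun M hM => ?_)) le_sup_left)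
    rcases hS' M hM with rfl | rfl
    exacts [le_rfl, (h hM).elim]

end Tense

theorem mainTheorem7 :
    ∃ Lstar : Tense.TenseLogic,
      Tense.IsSplittingPair Tense.K4t Tense.Frame.bullet.log Lstar ∧
      ∀ L ∈ Tense.NExt Tense.K4t,
        List.TFAE
          [ Tense.IsUnionSplitting Tense.K4t L,
            Tense.IsIteratedSplitting Tense.K4t L,
            Tense.df.{u} Tense.K4t L = 1,
            Tense.deg.{u} Tense.K4t L = 1,
            Tense.df.{u} Tense.K4t L ≠ 2 ^ Cardinal.aleph0,
            Tense.deg.{u} Tense.K4t L ≠ 2 ^ Cardinal.aleph0,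
            L = Tense.K4t ∨ L = Lstar ] := by
  refine ⟨Tense.K4tLinked, Tense.isSplittingPair_bullet, fun L hL => ?_⟩
  have hone : (1 : Cardinal.{0}) ≠ 2 ^ Cardinal.aleph0 :=
    (Cardinal.one_lt_aleph0.trans (Cardinal.cantor _)).ne
  tfae_have 1 → 7 := Tense.eq_of_isUnionSplitting
  tfae_have 2 → 7 := Tense.eq_of_isIteratedSplitting
  tfae_have 7 → 1 := by
    rintro (rfl | rfl)
    · exact ⟨∅, fun _ h => h.elim, by simp⟩
    · exact ⟨{Tense.K4tLinked}, fun _ h => Set.mem_singleton_iff.1 h ▸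
        ⟨_, Tense.isSplittingPair_bullet⟩, by
          rw [sSup_singleton, sup_eq_right.2 Tense.K4t_le_K4tLinked]⟩
  tfae_have 7 → 2 := by
    rintro (rfl | rfl)
    · exact .base
    · exact .step _ _ _ .base Tense.isSplittingPair_bullet
  tfae_have 7 → 3 := fun h => Tense.df_eq_one h hL
  tfae_have 7 → 4 := fun h => Tense.deg_eq_one h hL
  tfae_have 3 → 5 := fun h => h ▸ hone
  tfae_have 4 → 6 := fun h => h ▸ hone
  tfae_have 5 → 7 := fun h => by
    by_contra! hne
    exact h (Tense.df_eq_of_ne hL hne.1 hne.2)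
  tfae_have 6 → 7 := fun h => by
    by_contra! hne
    exact h (Tense.deg_eq_of_ne hL hne.1 hne.2)
  tfae_finish
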